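/- For $n\ge 3$ and $1\le k<n/2$, the generalized Petersen graph $P(n,k)$ has vertices $u_i,v_i$ $(0\le i\le n-1)$ and edges $u_iu_{i+1}$, $u_iv_i$, $v_iv_{i+k}$, subscripts taken modulo $n$. A $t$-rainbow domination function of a graph $G$ assigns to each vertex a (possibly empty) subset of $\{1,\dots,t\}$ so that every vertex that is assigned $\emptyset$ sees all $t$ colors in the union of the sets assigned to its neighbors; its weight is the sum of the cardinalities of the assigned sets, and $\gamma_{rt}(G)$ is the minimum weight of such a function. **Theorem.** Let $t\in\{4,5\}$, let $c\ge 3$ and $k\ge 1$ be integers, and write $\gamma=\gamma_{rt}(P(ck,k))$. 1. Let $c\equiv 0\pmod 6$. - If $k\equiv 1,5\pmod 6$, then $\gamma=\frac t3 ck$. - If $k\equiv 0\pmod 2$, then $\frac t3 ck<\gamma\le \frac t3\, c\left(k+\frac12\right)$. - If $k\equiv 3\pmod 6$, then $\frac t3 ck<\gamma\le \frac t3\, c(k+1)$. 2. Let $c$ be odd. - If $k\equiv 1,5\pmod 6$, then $\frac t3 ck<\gamma\le \frac t3\left(ck+\left\lceil\frac k2\right\rceil\right)$. - If $k\equiv 0\pmod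 2$, then $\frac t3 ck<\gamma\le \frac t3\left(ck+\left\lfloor\frac c2\right\rfloor+\frac k2\right)$. - If $k\equiv 3\pmod 6$, then $\frac t3 ck<\gamma\le \frac t3\left(c(k+1)+\left\lceil\frac{k-2}2\right\rceil\right)$. 3. Let $c$ be even and $c\not\equiv 0\pmod 6$. - If $k\equiv 1,5\pmod 6$, then $\frac t3 ck<\gamma\le \frac t3(ck+k+1)$. - If $k\equiv 0\pmod 2$, then $\frac t3 ck<\gamma\le \frac t3\left(ck+\frac c2+k\right)$. - If $k\equiv 3\pmod 6$, then $\frac t3 ck<\gamma\le \frac t3(ck+c+k-2)$. -/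

import Mathlib

/-- The generalized Petersen graph `P(n, k)`. The vertex `u_i` of the outer cycle is `Sum.inl i`, the
vertex `v_i` is `Sum.inr i`, with `0 ≤ i ≤ n - 1`. The edges are `u_i u_{i+1}`, `u_i v_i` and
`v_i v_{i+k}`, subscripts modulo `n` (`SimpleGraph.fromRel` makes the relation symmetric). -/
def generalizedPetersen (n k : ℕ) : SimpleGraph (Fin n ⊕ Fin n) :=
  SimpleGraph.fromRel fun x y =>
    match x, y with
    | Sum.inl i, Sum.inl j => (i.val + 1) % n = j.val
    | Sum.inl i, Sum.inr j => i = j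
    | Sum.inr i, Sum.inr j => (i.val + k) % n = j.val
    | Sum.inr _, Sum.inl _ => False

/-- `f` assigns to each vertex a subset of a set of `t` colors. It is a `t`-rainbow domination function
if each vertex that is assigned the empty set has all `t` colors in its neighborhood. -/
def IsRainbowDomination {V : Type*} (G : SimpleGraph V) (t : ℕ) (f : V → Finset (Fin t)) : Prop :=
  ∀ v, f v = ∅ → ∀ a : Fin t, ∃ u, G.Adj v u ∧ a ∈ f u

/-- The weight of an assignment: the total number of colors assigned to the vertices. -/
def rainbowWeight {V : Type*} [Fintype V] {t : ℕ} (f : V → Finset (Fin t)) : ℕ :=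
  ∑ v, (f v).card

/-- The `t`-rainbow domination number: the minimum weight of a `t`-rainbow domination function.
(The set of weights is a nonempty set of natural numbers, since all colors may be assigned to every
vertex, so `sInf` is its minimum.) -/
noncomputable def rainbowDominationNumber {V : Type*} [Fintype V] (t : ℕ) (G : SimpleGraph V) : ℕ :=
  sInf {w : ℕ | ∃ f : V → Finset (Fin t), IsRainbowDomination G t f ∧ rainbowWeight f = w}

/-!
Write a vertex subscript of `P(ck, k)` as `z = x + k * y` with `0 ≤ x < k` and `0 ≤ y < c`. The
vertices `u_z` and `v_z` then form a `k` by `c` grid of cells, in which `u` is adjacent to its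
horizontal neighbors, `v` to its vertical neighbors, and which is glued to itself along two seams.

*Lower bound.* `P(n, k)` is cubic. Let each vertex with `w > 0` colors send the charge `6 * w - t`
to each of its three neighbors. A vertex without colors sees all `t` colors, so it receives at
least `3 * t`; comparing what is sent with what is needed gives weight at least `t / 6` per vertex,
that is `t * n ≤ 3 * γ` (`mul_card_le_six_mul_rainbowWeight`). In the case of equality no two
vertices with colors are adjacent, and a vertex without colors has three neighbors with disjoint
nonempty sets of colors (`isTightRainbow_of_six_mul_rainbowWeight_eq`). Hence vertices with and
without colors alternate along the edges, which forces `n` even and `k` odd, and double counting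
the vertices with one given color forces `3 ∣ n`. Finally the cells containing a given color lift
to a set of points of the square lattice that meets certain horizontal and vertical triples exactly
once (`IsTightRainbow.exists_isTripleCode`). Such a set is invariant under horizontal translation
by `3`, while it has no two vertically adjacent points; as `(x + k, y)` and `(x, y + 1)` are the
same cell, `3 ∣ k` is impossible (`IsTripleCode.false_of_three_dvd`).

*Upper bounds.* Split the `t` colors into three nonempty classes, labelled by `ZMod 3`, and place
whole classes at vertices, so that each vertex carries a class or sees all three
(`IsRainbowPlacement`). Relabelling the classes cyclically gives three `t`-rainbow domination
functions, in which each placed class costs `t` altogether; so a placement of `N` classes gives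
`3 * γ ≤ t * N` (`three_mul_rainbowDominationNumber_le`). The basic placement puts the one class
`x + σ * y`, with `σ = ±1`, in the cell `(x, y)`, alternately at the outer and at the inner vertex.
It uses `c * k` classes and is correct except along the seams (`isRainbowPlacement_of_seams`).
According to the residues of `c` and `k`, each seam needs no repair, a further class in every
second place where two vertices without a class meet, or a further class in every place.

Two cases need more. If `c` is odd and `k` is even, the corner where the seams meet may ask for one
class too many. Each repair of a seam can then be done in two ways; choosing, for each relabelling
separately, the cheaper of two different classes saves a color at each place, and the corner can be
filled with a class of one color (`three_mul_rainbowDominationNumber_le_of_choice`). Only for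
`c = 5` and `6 ∣ k` are the savings too few. For this case, and for `c` even and not divisible by
`6` with `k ≡ 3` modulo `6`, the classes of a few cells next to the corner are changed by hand.
-/

/-! ### Vertices with integer subscripts -/

/-- The vertex `u_z` of `P(n, k)`, with the subscript `z : ℤ` read modulo `n`. -/
def outerVertex (n : ℕ) [NeZero n] (z : ℤ) : Fin n ⊕ Fin n :=
  Sum.inl ⟨(z % n).toNat, by
    have := NeZero.pos n
    have := Int.emod_lt_of_pos z (b := (n : ℤ)) (by omega)
    have := Int.emod_nonneg z (b := (n : ℤ)) (by omega)
    omega⟩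

/-- The vertex `v_z` of `P(n, k)`, with the subscript `z : ℤ` read modulo `n`. -/
def innerVertex (n : ℕ) [NeZero n] (z : ℤ) : Fin n ⊕ Fin n :=
  Sum.inr ⟨(z % n).toNat, by
    have := NeZero.pos n
    have := Int.emod_lt_of_pos z (b := (n : ℤ)) (by omega)
    have := Int.emod_nonneg z (b := (n : ℤ)) (by omega)
    omega⟩

section Vertices

variable {n : ℕ} [NeZero n]

lemma toNat_emod_eq_iff (z w : ℤ) :
    (z % n).toNat = (w % n).toNat ↔ z % n = w % n := by
  have h := NeZero.pos n
  have h1 := Int.emod_nonneg z (b := (n : ℤ)) (by omega)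
  have h2 := Int.emod_nonneg w (b := (n : ℤ)) (by omega)
  omega

lemma outerVertex_inj {z w : ℤ} : outerVertex n z = outerVertex n w ↔ z % n = w % n := by
  simp [outerVertex, toNat_emod_eq_iff]

lemma innerVertex_inj {z w : ℤ} : innerVertex n z = innerVertex n w ↔ z % n = w % n := by
  simp [innerVertex, toNat_emod_eq_iff]

lemma outerVertex_ne_innerVertex (z w : ℤ) : outerVertex n z ≠ innerVertex n w := by
  simp [outerVertex, innerVertex]

lemma outerVertex_val (i : Fin n) : outerVertex n (i.val : ℤ) = Sum.inl i := by
  have h : (i.val : ℤ) % n = i.val := Int.emod_eq_of_lt (by omega) (by exact_mod_cast i.isLt)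
  simp [outerVertex, h]

lemma innerVertex_val (i : Fin n) : innerVertex n (i.val : ℤ) = Sum.inr i := by
  have h : (i.val : ℤ) % n = i.val := Int.emod_eq_of_lt (by omega) (by exact_mod_cast i.isLt)
  simp [innerVertex, h]

lemma outerVertex_congr {z w : ℤ} (m : ℤ) (h : z = w + n * m) :
    outerVertex n z = outerVertex n w := by
  rw [outerVertex_inj, h, Int.add_mul_emod_self_left]

lemma innerVertex_congr {z w : ℤ} (m : ℤ) (h : z = w + n * m) :
    innerVertex n z = innerVertex n w := by
  rw [innerVertex_inj, h, Int.add_mul_emod_self_left]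

lemma vertex_cases (v : Fin n ⊕ Fin n) :
    (∃ z, v = outerVertex n z) ∨ ∃ z, v = innerVertex n z := by
  rcases v with i | i
  · exact Or.inl ⟨_, (outerVertex_val i).symm⟩
  · exact Or.inr ⟨_, (innerVertex_val i).symm⟩

lemma toNat_emod_add_emod (z : ℤ) (d : ℕ) (w : ℤ) :
    ((z % n).toNat + d) % n = (w % n).toNat ↔ (z + d) % n = w % n := by
  have h := NeZero.pos n
  have h1 := Int.emod_nonneg z (b := (n : ℤ)) (by omega)
  have h2 := Int.emod_nonneg w (b := (n : ℤ)) (by omega)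
  rw [← Int.emod_add_emod z n d, ← Int.natCast_inj]
  push_cast
  rw [Int.toNat_of_nonneg h1, Int.toNat_of_nonneg h2]

lemma outer_adj_iff (hn : 2 ≤ n) {k : ℕ} (z : ℤ) (w : Fin n ⊕ Fin n) :
    (generalizedPetersen n k).Adj (outerVertex n z) w ↔
      w = outerVertex n (z + 1) ∨ w = outerVertex n (z - 1) ∨ w = innerVertex n z := by
  have hsub : ∀ a b : ℤ, (a + 1) % n = b % n ↔ a % n = (b - 1) % n := fun a b => by
    constructor
    · intro h
      have := Int.ModEq.sub_right 1 (show a + 1 ≡ b [ZMOD n] from h)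
      simpa [Int.ModEq] using this
    · intro h
      have := Int.ModEq.add_right 1 (show a ≡ b - 1 [ZMOD n] from h)
      simpa [Int.ModEq] using this
  have hone : ∀ a : ℤ, (a + 1) % n ≠ a % n := fun a h => by
    have h1 : (n : ℤ) ∣ a + 1 - a := Int.ModEq.dvd (show a ≡ a + 1 [ZMOD n] from h.symm)
    have := Int.le_of_dvd (by omega) h1
    omega
  rcases vertex_cases w with ⟨y, rfl⟩ | ⟨y, rfl⟩
  · have e1 := toNat_emod_add_emod (n := n) z 1 y
    have e2 := toNat_emod_add_emod (n := n) y 1 z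
    push_cast at e1 e2
    rw [outerVertex_inj, outerVertex_inj, generalizedPetersen, SimpleGraph.fromRel_adj,
      ne_eq, outerVertex_inj]
    simp only [outerVertex, e1, e2, hsub y z]
    have hz := hone z
    have hz' := hone (z - 1)
    rw [sub_add_cancel] at hz'
    constructor
    · rintro ⟨-, h | h⟩
      · exact Or.inl h.symm
      · exact Or.inr (Or.inl h)
    · rintro (h | h | h)
      · exact ⟨fun h' => hz (h ▸ h'.symm), Or.inl h.symm⟩
      · exact ⟨fun h' => hz' (h'.trans h), Or.inr h⟩
      · simp [innerVertex] at h
  · rw [generalizedPetersen, SimpleGraph.fromRel_adj]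
    simp only [(outerVertex_ne_innerVertex _ _).symm, innerVertex_inj]
    simp [outerVertex, innerVertex, toNat_emod_eq_iff, eq_comm]

lemma inner_adj_iff {k : ℕ} (hk : 1 ≤ k) (hkn : k < n) (z : ℤ) (w : Fin n ⊕ Fin n) :
    (generalizedPetersen n k).Adj (innerVertex n z) w ↔
      w = innerVertex n (z + k) ∨ w = innerVertex n (z - k) ∨ w = outerVertex n z := by
  have hsub : ∀ a b : ℤ, (a + k) % n = b % n ↔ a % n = (b - k) % n := fun a b => by
    constructor
    · intro h
      have := Int.ModEq.sub_right k (show a + k ≡ b [ZMOD n] from h)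
      simpa [Int.ModEq] using this
    · intro h
      have := Int.ModEq.add_right k (show a ≡ b - k [ZMOD n] from h)
      simpa [Int.ModEq] using this
  have hone : ∀ a : ℤ, (a + k) % n ≠ a % n := fun a h => by
    have h1 : (n : ℤ) ∣ a + k - a := Int.ModEq.dvd (show a ≡ a + k [ZMOD n] from h.symm)
    have := Int.le_of_dvd (by omega) h1
    omega
  rcases vertex_cases w with ⟨y, rfl⟩ | ⟨y, rfl⟩
  · rw [generalizedPetersen, SimpleGraph.fromRel_adj]
    simp only [outerVertex_ne_innerVertex, outerVertex_inj]
    simp [outerVertex, innerVertex, toNat_emod_eq_iff]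
  · have e1 := toNat_emod_add_emod (n := n) z k y
    have e2 := toNat_emod_add_emod (n := n) y k z
    rw [innerVertex_inj, innerVertex_inj, generalizedPetersen, SimpleGraph.fromRel_adj,
      ne_eq, innerVertex_inj]
    simp only [innerVertex, e1, e2, hsub y z]
    have hz := hone z
    have hz' := hone (z - k)
    rw [sub_add_cancel] at hz'
    constructor
    · rintro ⟨-, h | h⟩
      · exact Or.inl h.symm
      · exact Or.inr (Or.inl h)
    · rintro (h | h | h)
      · exact ⟨fun h' => hz (h ▸ h'.symm), Or.inl h.symm⟩
      · exact ⟨fun h' => hz' (h'.trans h), Or.inr h⟩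
      · simp [outerVertex] at h

end Vertices

/-! ### Discharging in cubic graphs -/

section Discharging

variable {V : Type*} {t : ℕ}

/-- In the discharging argument a vertex with a nonempty set of `w` colors sends the charge
`6 * w - t` to each of its neighbors; a vertex with no colors sends nothing. -/
def sentCharge (f : V → Finset (Fin t)) (v : V) : ℤ :=
  if f v = ∅ then 0 else 6 * (f v).card - t

lemma sentCharge_nonneg (ht : t ≤ 6) (f : V → Finset (Fin t)) (v : V) : 0 ≤ sentCharge f v := by
  unfold sentCharge
  split_ifs with h
  · exact le_rfl
  · have := Finset.card_pos.2 (Finset.nonempty_iff_ne_empty.2 h)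
    omega

lemma le_sentCharge (f : V → Finset (Fin t)) (v : V) :
    6 * ((f v).card : ℤ) - t ≤ sentCharge f v := by
  unfold sentCharge
  split_ifs with h
  · simp [h]
  · exact le_rfl

lemma sentCharge_pos (ht : t < 6) (f : V → Finset (Fin t)) {v : V} (h : f v ≠ ∅) :
    0 < sentCharge f v := by
  have := Finset.card_pos.2 (Finset.nonempty_iff_ne_empty.2 h)
  rw [sentCharge, if_neg h]
  omega

lemma sum_card_eq_sum_card_filter (s : Finset V) (f : V → Finset (Fin t)) :
    ∑ u ∈ s, (f u).card = ∑ a, (s.filter fun u => a ∈ f u).card := by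
  simp only [Finset.card_eq_sum_ones, Finset.sum_filter]
  rw [Finset.sum_comm]
  refine Finset.sum_congr rfl fun u _ => ?_
  rw [← Finset.sum_filter]
  simp

variable [Fintype V] {G : SimpleGraph V} [DecidableRel G.Adj]

/-- The charge received by `v` beyond what `v` needs: a vertex with no colors needs `3 * t`. -/
def excessCharge (G : SimpleGraph V) [DecidableRel G.Adj] (f : V → Finset (Fin t)) (v : V) : ℤ :=
  ∑ u ∈ G.neighborFinset v, sentCharge f u - if f v = ∅ then 3 * (t : ℤ) else 0

lemma sum_sum_neighborFinset (hG : G.IsRegularOfDegree 3) (g : V → ℤ) :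
    ∑ v, ∑ u ∈ G.neighborFinset v, g u = 3 * ∑ v, g v := by
  rw [Finset.sum_comm' (t' := Finset.univ) (s' := fun u => G.neighborFinset u)
    (by simp [G.adj_comm]), Finset.mul_sum]
  refine Finset.sum_congr rfl fun u _ => ?_
  rw [Finset.sum_const, G.card_neighborFinset_eq_degree, hG u]
  simp

lemma sum_excessCharge (hG : G.IsRegularOfDegree 3) (f : V → Finset (Fin t)) :
    ∑ v, excessCharge G f v = 3 * (6 * (rainbowWeight f : ℤ) - t * Fintype.card V) := by
  have h1 : ∀ v, (3 * sentCharge f v - if f v = ∅ then 3 * (t : ℤ) else 0) =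
      3 * (6 * ((f v).card : ℤ) - t) := fun v => by
    unfold sentCharge
    split_ifs with h
    · simp [h]
    · ring
  simp only [excessCharge]
  rw [Finset.sum_sub_distrib, sum_sum_neighborFinset hG, Finset.mul_sum, ← Finset.sum_sub_distrib,
    Finset.sum_congr rfl fun v _ => h1 v, ← Finset.mul_sum, Finset.sum_sub_distrib,
    ← Finset.mul_sum]
  simp [rainbowWeight, mul_comm]

lemma one_le_card_filter {f : V → Finset (Fin t)} (hf : IsRainbowDomination G t f) {v : V}
    (hv : f v = ∅) (a : Fin t) : 1 ≤ ((G.neighborFinset v).filter fun u => a ∈ f u).card := by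
  obtain ⟨u, hu, ha⟩ := hf v hv a
  exact Finset.card_pos.2 ⟨u, by simp [hu, ha]⟩

lemma le_sum_card {f : V → Finset (Fin t)} (hf : IsRainbowDomination G t f) {v : V}
    (hv : f v = ∅) : t ≤ ∑ u ∈ G.neighborFinset v, (f u).card := by
  rw [sum_card_eq_sum_card_filter]
  calc t = ∑ _a : Fin t, 1 := by simp
    _ ≤ _ := Finset.sum_le_sum fun a _ => one_le_card_filter hf hv a

lemma sum_six_mul_card_sub (hG : G.IsRegularOfDegree 3) (f : V → Finset (Fin t)) (v : V) :
    ∑ u ∈ G.neighborFinset v, (6 * ((f u).card : ℤ) - t) =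
      6 * ((∑ u ∈ G.neighborFinset v, (f u).card : ℕ) : ℤ) - 3 * t := by
  rw [Finset.sum_sub_distrib, ← Finset.mul_sum, Finset.sum_const,
    G.card_neighborFinset_eq_degree, hG v]
  simp

lemma excessCharge_nonneg (hG : G.IsRegularOfDegree 3) (ht : t ≤ 6) {f : V → Finset (Fin t)}
    (hf : IsRainbowDomination G t f) (v : V) : 0 ≤ excessCharge G f v := by
  unfold excessCharge
  split_ifs with h
  · have h1 := Finset.sum_le_sum fun u (_ : u ∈ G.neighborFinset v) => le_sentCharge f u
    rw [sum_six_mul_card_sub hG] at h1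
    have h2 := le_sum_card hf h
    omega
  · simpa using Finset.sum_nonneg fun u _ => sentCharge_nonneg ht f u

/-- A `t`-rainbow domination function, `t ≤ 6`, of a cubic graph has weight at least `t / 6` times
the number of vertices. -/
lemma mul_card_le_six_mul_rainbowWeight (hG : G.IsRegularOfDegree 3) (ht : t ≤ 6)
    {f : V → Finset (Fin t)} (hf : IsRainbowDomination G t f) :
    t * Fintype.card V ≤ 6 * rainbowWeight f := by
  have h1 := Finset.sum_nonneg fun v (_ : v ∈ Finset.univ) => excessCharge_nonneg hG ht hf v
  rw [sum_excessCharge hG] at h1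
  zify
  linarith

/-- A `t`-rainbow domination function is tight if no vertex with a color has a neighbor with a
color, and each vertex without colors has three neighbors with disjoint nonempty sets of colors. -/
structure IsTightRainbow (G : SimpleGraph V) (t : ℕ) (f : V → Finset (Fin t)) : Prop where
  empty_of_adj : ∀ {v u}, f v ≠ ∅ → G.Adj v u → f u = ∅
  nonempty_of_adj : ∀ {v u}, f v = ∅ → G.Adj v u → f u ≠ ∅
  existsUnique : ∀ {v}, f v = ∅ → ∀ a, ∃! u, G.Adj v u ∧ a ∈ f u

/-- In the case of equality every inequality of the discharging argument is an equality. -/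
lemma isTightRainbow_of_six_mul_rainbowWeight_eq (hG : G.IsRegularOfDegree 3) (ht0 : 0 < t)
    (ht : t < 6) {f : V → Finset (Fin t)} (hf : IsRainbowDomination G t f)
    (h : 6 * rainbowWeight f = t * Fintype.card V) : IsTightRainbow G t f := by
  have hzero : ∀ v, excessCharge G f v = 0 := by
    have h1 : ∑ v, excessCharge G f v = 0 := by
      rw [sum_excessCharge hG]
      have : (6 * rainbowWeight f : ℤ) = t * Fintype.card V := by exact_mod_cast h
      rw [this]
      ring
    intro v
    exact (Finset.sum_eq_zero_iff_of_nonneg fun v _ => excessCharge_nonneg hG ht.le hf v).1 h1 v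
      (Finset.mem_univ v)
  have hempty : ∀ {v}, f v = ∅ → (∑ u ∈ G.neighborFinset v, (f u).card = t) ∧
      ∀ u, G.Adj v u → sentCharge f u = 6 * ((f u).card : ℤ) - t := by
    intro v hv
    have h0 := hzero v
    rw [excessCharge, if_pos hv] at h0
    have h1 := Finset.sum_le_sum fun u (_ : u ∈ G.neighborFinset v) => le_sentCharge f u
    have h2 := le_sum_card hf hv
    have h3 := sum_six_mul_card_sub hG f v
    refine ⟨by omega, fun u hu => ?_⟩
    have h4 : ∑ u ∈ G.neighborFinset v, (6 * ((f u).card : ℤ) - t) =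
        ∑ u ∈ G.neighborFinset v, sentCharge f u := by omega
    exact ((Finset.sum_eq_sum_iff_of_le fun u _ => le_sentCharge f u).1 h4 u
      (by simpa using hu)).symm
  refine ⟨fun {v u} hv hu => ?_, fun {v u} hv hu hu0 => ?_, fun {v} hv a => ?_⟩
  · by_contra hu0
    have h0 := hzero v
    rw [excessCharge, if_neg hv, sub_zero,
      Finset.sum_eq_zero_iff_of_nonneg fun u _ => sentCharge_nonneg ht.le f u] at h0
    have h1 := h0 u (by simpa using hu)
    have h2 := sentCharge_pos ht f hu0
    omega
  · have h1 := (hempty hv).2 u hu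
    rw [sentCharge, if_pos hu0, hu0] at h1
    simp at h1
    omega
  · have h1 := (hempty hv).1
    rw [sum_card_eq_sum_card_filter] at h1
    have h2 : ∑ _a : Fin t, 1 = ∑ a, ((G.neighborFinset v).filter fun u => a ∈ f u).card := by
      rw [h1]
      simp
    have h3 := (Finset.sum_eq_sum_iff_of_le fun a _ => one_le_card_filter hf hv a).1 h2 a
      (Finset.mem_univ a)
    obtain ⟨u, hu⟩ := Finset.card_eq_one.1 h3.symm
    have hmem : ∀ w, G.Adj v w ∧ a ∈ f w ↔ w = u := fun w => by
      rw [← Finset.mem_singleton, ← hu]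
      simp
    exact ⟨u, (hmem u).2 rfl, fun w hw => (hmem w).1 hw⟩

end Discharging

/-! ### `P(n, k)` is cubic -/

section Cubic

lemma generalizedPetersen_isRegularOfDegree {n k : ℕ} (hk : 1 ≤ k) (hkn : 2 * k < n)
    [DecidableRel (generalizedPetersen n k).Adj] :
    (generalizedPetersen n k).IsRegularOfDegree 3 := by
  have : NeZero n := ⟨by omega⟩
  have hne : ∀ z : ℤ, ∀ d : ℕ, 1 ≤ d → 2 * d < n → (z + d) % n ≠ (z - d) % n := by
    intro z d h1 h2 h
    have h3 : (n : ℤ) ∣ z + d - (z - d) := Int.ModEq.dvd (show z - d ≡ z + d [ZMOD n] from h.symm)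
    have := Int.le_of_dvd (by omega) h3
    omega
  intro v
  rw [← SimpleGraph.card_neighborFinset_eq_degree, Finset.card_eq_three]
  rcases vertex_cases v with ⟨z, rfl⟩ | ⟨z, rfl⟩
  · refine ⟨outerVertex n (z + 1), outerVertex n (z - 1), innerVertex n z, ?_,
      outerVertex_ne_innerVertex _ _, outerVertex_ne_innerVertex _ _, ?_⟩
    · rw [ne_eq, outerVertex_inj]
      exact_mod_cast hne z 1 le_rfl (by omega)
    · ext w
      simp [outer_adj_iff (n := n) (by omega) z w]
  · refine ⟨innerVertex n (z + k), innerVertex n (z - k), outerVertex n z, ?_,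
      (outerVertex_ne_innerVertex _ _).symm, (outerVertex_ne_innerVertex _ _).symm, ?_⟩
    · rw [ne_eq, innerVertex_inj]
      exact hne z k hk hkn
    · ext w
      simp [inner_adj_iff (n := n) hk (by omega) z w]

end Cubic

/-! ### Perfect codes on the square lattice -/

section Lattice

/-- A set `A` of lattice points is a triple code, with parity offset `s`, if it has exactly one
point in each horizontal triple centred at a point `(x, y)` with `x + y + s` odd, and in each
vertical triple centred at a point with `x + y + s` even. The points with a given color of a tight
function on `P(n, k)`, unrolled along `(x, y) ↦ x + k * y`, form such a set. -/
structure IsTripleCode (A : ℤ → ℤ → Prop) (s : ℤ) : Prop where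
  horizontal : ∀ x y, Odd (x + y + s) → (A (x - 1) y ∨ A x y ∨ A (x + 1) y) ∧
    ¬ (A (x - 1) y ∧ A x y) ∧ ¬ (A x y ∧ A (x + 1) y) ∧ ¬ (A (x - 1) y ∧ A (x + 1) y)
  vertical : ∀ x y, Even (x + y + s) → (A x (y - 1) ∨ A x y ∨ A x (y + 1)) ∧
    ¬ (A x (y - 1) ∧ A x y) ∧ ¬ (A x y ∧ A x (y + 1)) ∧ ¬ (A x (y - 1) ∧ A x (y + 1))

variable {A : ℤ → ℤ → Prop} {s : ℤ}

lemma IsTripleCode.swap (h : IsTripleCode A s) : IsTripleCode (fun x y => A y x) (s + 1) where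
  horizontal x y hxy := h.vertical y x (by grind)
  vertical x y hxy := h.horizontal y x (by grind)

lemma IsTripleCode.reflect (h : IsTripleCode A s) : IsTripleCode (fun x y => A x (-y)) s where
  horizontal x y hxy := h.horizontal x (-y) (by grind)
  vertical x y hxy := by
    have := h.vertical x (-y) (by grind)
    rw [show -(y - 1) = -y + 1 by ring, show -(y + 1) = -y - 1 by ring]
    tauto

/-- Around a point of a triple code the code follows one of the two diagonals. -/
lemma IsTripleCode.diagonal_of_even (h : IsTripleCode A s) {x y : ℤ} (hxy : Even (x + y + s))
    (hA : A x y) :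
    (A (x + 1) (y + 1) ∧ ¬ A (x - 1) (y + 1) ∧ A (x - 1) (y - 1) ∧ A (x - 1) (y + 2) ∧
      A (x + 1) (y - 2)) ∨
    (A (x - 1) (y + 1) ∧ ¬ A (x + 1) (y + 1) ∧ ¬ A (x - 1) (y - 1) ∧ A (x + 1) (y - 1)) := by
  have h1 := h.horizontal (x + 1) y (by grind)
  have h2 := h.horizontal (x - 1) y (by grind)
  have h3 := h.horizontal x (y + 1) (by grind)
  have h4 := h.horizontal x (y - 1) (by grind)
  have h5 := h.horizontal (x + 2) (y + 1) (by grind)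
  have h6 := h.horizontal (x + 2) (y - 1) (by grind)
  have h7 := h.horizontal (x - 2) (y + 1) (by grind)
  have h8 := h.horizontal (x - 2) (y - 1) (by grind)
  have v1 := h.vertical x y hxy
  have v2 := h.vertical (x + 1) (y - 1) (by grind)
  have v3 := h.vertical (x - 1) (y + 1) (by grind)
  have v4 := h.vertical (x + 2) y (by grind)
  have v5 := h.vertical (x - 2) y (by grind)
  simp only [show x + 1 - 1 = x by ring, show x - 1 + 1 = x by ring, show x + 1 + 1 = x + 2 by ring,
    show x - 1 - 1 = x - 2 by ring, show x + 2 - 1 = x + 1 by ring, show x - 2 + 1 = x - 1 by ring,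
    show y + 1 - 1 = y by ring, show y - 1 + 1 = y by ring, show y + 1 + 1 = y + 2 by ring,
    show y - 1 - 1 = y - 2 by ring] at *
  clear h hxy
  generalize A (x + 2) (y + 1) = a1 at *
  generalize A (x + 2) (y - 1) = a2 at *
  generalize A (x - 2) (y + 1) = a3 at *
  generalize A (x - 2) (y - 1) = a4 at *
  grind

lemma IsTripleCode.diagonal_step_of_even (h : IsTripleCode A s) {x y : ℤ} (hxy : Even (x + y + s))
    (hA : A x y) (hA' : A (x + 1) (y + 1)) :
    (A (x + 3) y ∧ A (x + 4) (y + 1)) ∧ A x (y + 3) ∧ A (x + 1) (y + 4) := by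
  have step : ∀ a b : ℤ, Even (a + b + s) → A a b → A (a + 1) (b + 1) →
      A (a + 2) (b + 2) ∧ A a (b + 3) ∧ A (a + 2) (b - 1) := by
    intro a b hab h1 h2
    rcases h.diagonal_of_even (x := a + 1) (y := b + 1) (by grind) h2 with h3 | h3
    · simp only [add_assoc, add_sub_cancel_right] at h3
      norm_num at h3
      refine ⟨h3.1, h3.2.2.2.1, ?_⟩
      have := h3.2.2.2.2
      rwa [show b + 1 - 2 = b - 1 by ring] at this
    · exact absurd (by simpa using h1) h3.2.2.1
  have s1 := step x y hxy hA hA'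
  have s2 := step (x + 1) (y + 1) (by grind) hA' (by simpa [add_assoc] using s1.1)
  have s3 := step (x + 2) (y + 2) (by grind) s1.1 (by simpa [add_assoc] using s2.1)
  simp only [add_assoc] at s1 s2 s3
  norm_num at s1 s2 s3
  rw [show y + 2 - 1 = y + 1 by ring] at s3
  exact ⟨⟨s2.2.2, s3.2.2⟩, s1.2.1, s2.2.1⟩

lemma IsTripleCode.diagonal_step (h : IsTripleCode A s) {x y : ℤ}
    (hA : A x y) (hA' : A (x + 1) (y + 1)) : A (x + 3) y ∧ A (x + 3 + 1) (y + 1) := by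
  rw [show x + 3 + 1 = x + 4 by ring]
  by_cases hxy : Even (x + y + s)
  · exact (h.diagonal_step_of_even hxy hA hA').1
  · exact (h.swap.diagonal_step_of_even (x := y) (y := x) (by grind) hA hA').2

lemma IsTripleCode.diagonal_shift (h : IsTripleCode A s) {x y : ℤ}
    (hA : A x y) (hA' : A (x + 1) (y + 1)) (m : ℕ) :
    A (x + 3 * m) y ∧ A (x + 3 * m + 1) (y + 1) := by
  induction m with
  | zero => simpa using ⟨hA, hA'⟩
  | succ m ih =>
    have := h.diagonal_step ih.1 ih.2
    rwa [show x + 3 * (m : ℤ) + 3 = x + 3 * ((m + 1 : ℕ) : ℤ) by push_cast; ring] at this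

/-- A triple code is invariant under horizontal translation by `3`. -/
lemma IsTripleCode.horizontal_shift (h : IsTripleCode A s) {x y : ℤ} (hA : A x y) (m : ℕ) :
    A (x + 3 * m) y := by
  have key : A (x + 1) (y + 1) ∨ A (x + 1) (y - 1) := by
    by_cases hxy : Even (x + y + s)
    · have := h.diagonal_of_even hxy hA
      tauto
    · have := h.swap.diagonal_of_even (x := y) (y := x) (by grind) hA
      tauto
  rcases key with h1 | h1
  · exact (h.diagonal_shift hA h1 m).1
  · have := (h.reflect.diagonal_shift (x := x) (y := -y) (by simpa using hA)
      (by rwa [show -(-y + 1) = y - 1 by ring]) m).1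
    simpa using this

/-- If `3 ∣ k`, a triple code does not descend to the quotient of the lattice in which `(x + k, y)`
is identified with `(x, y + 1)`. -/
lemma IsTripleCode.false_of_three_dvd (h : IsTripleCode A s) {k : ℕ} (hk : 3 ∣ k)
    (hA : ∀ x y, A (x + k) y ↔ A x (y + 1)) : False := by
  obtain ⟨q, rfl⟩ := hk
  obtain ⟨x, y, hxy⟩ : ∃ x y, A x y := by
    rcases (h.horizontal (1 - s) 0 (by simp)).1 with h | h | h <;> exact ⟨_, _, h⟩
  have h1 : A x (y + 1) := by
    rw [← hA]
    push_cast
    exact h.horizontal_shift hxy q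
  by_cases hp : Even (x + y + s)
  · exact (h.vertical x y hp).2.2.1 ⟨hxy, h1⟩
  · have := (h.vertical x (y + 1) (by grind)).2.1
    rw [add_sub_cancel_right] at this
    exact this ⟨hxy, h1⟩

end Lattice

/-! ### The lower bound for `P(n, k)` -/

section TightPetersen

variable {n k t : ℕ} [NeZero n] {f : Fin n ⊕ Fin n → Finset (Fin t)}

lemma IsTightRainbow.eq_empty_iff {V : Type*} {G : SimpleGraph V} {f : V → Finset (Fin t)}
    (h : IsTightRainbow G t f) {v u : V} (hvu : G.Adj v u) : f u = ∅ ↔ f v ≠ ∅ :=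
  ⟨fun hu hv => h.nonempty_of_adj hv hvu hu, fun hv => h.empty_of_adj hv hvu⟩

lemma IsTightRainbow.outer_eq_empty_iff (hn : 2 ≤ n)
    (h : IsTightRainbow (generalizedPetersen n k) t f) (z : ℤ) :
    f (outerVertex n z) = ∅ ↔ (f (outerVertex n 0) = ∅ ↔ Even z) := by
  have step : ∀ z, f (outerVertex n (z + 1)) = ∅ ↔ f (outerVertex n z) ≠ ∅ := fun z =>
    h.eq_empty_iff ((outer_adj_iff hn z _).2 (Or.inl rfl))
  induction z using Int.induction_on with
  | zero => simp
  | succ i ih =>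
    have := step i
    have h2 : Even ((i : ℤ) + 1) ↔ ¬ Even (i : ℤ) := Int.even_add_one
    rw [h2]
    tauto
  | pred i ih =>
    have := step (-i - 1)
    rw [sub_add_cancel] at this
    have h2 : Even (-(i : ℤ) - 1) ↔ ¬ Even (-(i : ℤ)) := by grind
    rw [h2]
    tauto

lemma IsTightRainbow.inner_eq_empty_iff (hn : 2 ≤ n)
    (h : IsTightRainbow (generalizedPetersen n k) t f) (z : ℤ) :
    f (innerVertex n z) = ∅ ↔ f (outerVertex n z) ≠ ∅ :=
  h.eq_empty_iff ((outer_adj_iff hn z _).2 (Or.inr (Or.inr rfl)))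

lemma IsTightRainbow.even_order (hn : 2 ≤ n)
    (h : IsTightRainbow (generalizedPetersen n k) t f) : Even n := by
  have h1 := h.outer_eq_empty_iff hn n
  rw [outerVertex_congr (n := n) (z := n) (w := 0) 1 (by ring)] at h1
  have h2 : Even (n : ℤ) := by tauto
  exact_mod_cast h2

lemma IsTightRainbow.odd_skip (hn : 2 ≤ n) (hk : 1 ≤ k) (hkn : k < n)
    (h : IsTightRainbow (generalizedPetersen n k) t f) : Odd k := by
  have h1 := h.outer_eq_empty_iff hn k
  have h2 := h.inner_eq_empty_iff hn k
  have h3 := h.inner_eq_empty_iff hn 0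
  have h4 := h.eq_empty_iff ((inner_adj_iff hk hkn 0 _).2 (Or.inl rfl))
  rw [zero_add] at h4
  have h5 : ¬ Even (k : ℤ) := by tauto
  rw [← Nat.not_even_iff_odd]
  exact_mod_cast h5

/-- Count the edges from vertices with a given color: each of the `n` vertices without colors lies
on exactly one of them, each vertex with that color on three. -/
lemma IsTightRainbow.three_dvd_order (hk : 1 ≤ k) (hkn : 2 * k < n) (ht : 0 < t)
    (h : IsTightRainbow (generalizedPetersen n k) t f) : 3 ∣ n := by
  classical
  have hG := generalizedPetersen_isRegularOfDegree hk hkn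
  have h1 := sum_sum_neighborFinset hG fun v => if (⟨0, ht⟩ : Fin t) ∈ f v then 1 else 0
  have h2 : ∀ v, (∑ u ∈ (generalizedPetersen n k).neighborFinset v,
      if (⟨0, ht⟩ : Fin t) ∈ f u then (1 : ℤ) else 0) = if f v = ∅ then 1 else 0 := by
    intro v
    split_ifs with hv
    · obtain ⟨u, hu, huniq⟩ := h.existsUnique hv ⟨0, ht⟩
      rw [Finset.sum_eq_single u]
      · simp [hu.2]
      · intro w hw hwu
        rw [if_neg]
        exact fun hw' => hwu (huniq w ⟨by simpa using hw, hw'⟩)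
      · intro hu'
        exact absurd (by simpa using hu.1) hu'
    · refine Finset.sum_eq_zero fun u hu => ?_
      rw [h.empty_of_adj hv (by simpa using hu)]
      simp
  simp only [h2, Fintype.sum_sum_type] at h1
  rw [← Finset.sum_add_distrib] at h1
  have h3 : ∀ i : Fin n, ((if f (Sum.inl i) = ∅ then 1 else 0) +
      if f (Sum.inr i) = ∅ then 1 else 0 : ℤ) = 1 := by
    intro i
    have := h.inner_eq_empty_iff (by omega) i
    rw [outerVertex_val, innerVertex_val] at this
    by_cases h' : f (Sum.inl i) = ∅ <;> simp_all
  rw [Finset.sum_congr rfl fun i _ => h3 i] at h1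
  simp only [Finset.sum_const, Finset.card_univ, Fintype.card_fin, nsmul_eq_mul, mul_one] at h1
  exact Int.natCast_dvd_natCast.1 ⟨_, h1⟩

/-- The set of lattice points `(x, y)` such that the color `a` appears at `u_z` or at `v_z`, where
`z = x + k * y`, is a triple code. -/
lemma IsTightRainbow.exists_isTripleCode (hk : 1 ≤ k) (hkn : 2 * k < n)
    (h : IsTightRainbow (generalizedPetersen n k) t f) (a : Fin t) :
    ∃ s, IsTripleCode (fun x y => a ∈ f (outerVertex n (x + k * y)) ∨
      a ∈ f (innerVertex n (x + k * y))) s := by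
  have hn : 2 ≤ n := by omega
  have hodd : Odd (k : ℤ) := by exact_mod_cast h.odd_skip hn hk (by omega)
  obtain ⟨s, hs⟩ : ∃ s : ℤ, ∀ z, f (outerVertex n z) = ∅ ↔ Odd (z + s) := by
    by_cases h0 : f (outerVertex n 0) = ∅
    · exact ⟨1, fun z => by rw [h.outer_eq_empty_iff hn z]; grind⟩
    · exact ⟨0, fun z => by rw [h.outer_eq_empty_iff hn z]; grind⟩
  have hs' : ∀ z, f (innerVertex n z) = ∅ ↔ Even (z + s) := fun z => by
    rw [h.inner_eq_empty_iff hn, ne_eq, hs, Int.not_odd_iff_even]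
  have hne : ∀ z : ℤ, ∀ d : ℕ, 1 ≤ d → 2 * d < n → (z - d) % n ≠ (z + d) % n := by
    intro z d h1 h2 h
    have h3 : (n : ℤ) ∣ z + d - (z - d) := Int.ModEq.dvd (show z - d ≡ z + d [ZMOD n] from h)
    have := Int.le_of_dvd (by omega) h3
    omega
  have hpar : ∀ x y : ℤ, Even (x + k * y + s) ↔ Even (x + y + s) := fun x y => by
    obtain ⟨m, hm⟩ := hodd
    rw [hm]
    have : x + (2 * m + 1) * y + s = x + y + s + 2 * (m * y) := by ring
    rw [this]
    simp [parity_simps]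
  refine ⟨s, fun x y hxy => ?_, fun x y hxy => ?_⟩
  · set z : ℤ := x + k * y with hz
    have hzs : Odd (z + s) := by
      rw [← Int.not_even_iff_odd, hpar, Int.not_even_iff_odd]
      exact hxy
    rw [show x - 1 + k * y = z - 1 by rw [hz]; ring, show x + 1 + k * y = z + 1 by rw [hz]; ring,
      (hs z).2 hzs, (hs' (z - 1)).2 (by grind), (hs' (z + 1)).2 (by grind)]
    obtain ⟨u, ⟨hu, hau⟩, huniq⟩ := h.existsUnique ((hs z).2 hzs) a
    simp only [outer_adj_iff hn] at hu huniq
    have h1 : outerVertex n (z - 1) ≠ outerVertex n (z + 1) := by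
      rw [ne_eq, outerVertex_inj]
      exact_mod_cast hne z 1 le_rfl (by omega)
    have h2 := outerVertex_ne_innerVertex (n := n) (z - 1) z
    have h3 := outerVertex_ne_innerVertex (n := n) (z + 1) z
    simp only [Finset.notMem_empty, or_false, false_or]
    refine ⟨?_, fun h' => h2 ?_, fun h' => h3 ?_, fun h' => h1 ?_⟩
    · rcases hu with rfl | rfl | rfl <;> tauto
    · rw [huniq _ ⟨by tauto, h'.1⟩, huniq (innerVertex n z) ⟨by tauto, h'.2⟩]
    · rw [huniq _ ⟨by tauto, h'.2⟩, huniq (innerVertex n z) ⟨by tauto, h'.1⟩]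
    · rw [huniq _ ⟨by tauto, h'.1⟩, huniq (outerVertex n (z + 1)) ⟨by tauto, h'.2⟩]
  · set z : ℤ := x + k * y with hz
    have hzs : Even (z + s) := by
      rw [hpar]
      exact hxy
    rw [show x + k * (y - 1) = z - k by rw [hz]; ring,
      show x + k * (y + 1) = z + k by rw [hz]; ring,
      (hs' z).2 hzs, (hs (z - k)).2 (by grind), (hs (z + k)).2 (by grind)]
    obtain ⟨u, ⟨hu, hau⟩, huniq⟩ := h.existsUnique ((hs' z).2 hzs) a
    simp only [inner_adj_iff (n := n) hk (by omega)] at hu huniq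
    have h1 : innerVertex n (z - k) ≠ innerVertex n (z + k) := by
      rw [ne_eq, innerVertex_inj]
      exact hne z k hk hkn
    have h2 := (outerVertex_ne_innerVertex (n := n) z (z - k)).symm
    have h3 := (outerVertex_ne_innerVertex (n := n) z (z + k)).symm
    simp only [Finset.notMem_empty, or_false, false_or]
    refine ⟨?_, fun h' => h2 ?_, fun h' => h3 ?_, fun h' => h1 ?_⟩
    · rcases hu with rfl | rfl | rfl <;> tauto
    · rw [huniq _ ⟨by tauto, h'.1⟩, huniq (outerVertex n z) ⟨by tauto, h'.2⟩]
    · rw [huniq _ ⟨by tauto, h'.2⟩, huniq (outerVertex n z) ⟨by tauto, h'.1⟩]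
    · rw [huniq _ ⟨by tauto, h'.1⟩, huniq (innerVertex n (z + k)) ⟨by tauto, h'.2⟩]

lemma IsTightRainbow.not_three_dvd_skip (hk : 1 ≤ k) (hkn : 2 * k < n) (ht : 0 < t)
    (h : IsTightRainbow (generalizedPetersen n k) t f) : ¬ 3 ∣ k := by
  intro h3
  obtain ⟨s, hs⟩ := h.exists_isTripleCode hk hkn ⟨0, ht⟩
  refine hs.false_of_three_dvd h3 fun x y => ?_
  rw [show x + k + k * y = x + k * (y + 1) by ring]

end TightPetersen

section LowerBound

variable {n k t : ℕ}

lemma exists_rainbowWeight_eq {V : Type*} [Fintype V] (G : SimpleGraph V) (ht : 0 < t) :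
    ∃ f : V → Finset (Fin t), IsRainbowDomination G t f ∧
      rainbowWeight f = rainbowDominationNumber t G := by
  have hne : {w : ℕ | ∃ f : V → Finset (Fin t), IsRainbowDomination G t f ∧
      rainbowWeight f = w}.Nonempty := by
    refine ⟨_, fun _ => Finset.univ, fun v hv => ?_, rfl⟩
    have h0 := Finset.mem_univ (⟨0, ht⟩ : Fin t)
    simp only at hv
    rw [hv] at h0
    exact absurd h0 (Finset.notMem_empty _)
  exact Nat.sInf_mem hne

lemma mul_le_three_mul_rainbowDominationNumber (hk : 1 ≤ k) (hkn : 2 * k < n) (ht0 : 0 < t)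
    (ht : t ≤ 6) : t * n ≤ 3 * rainbowDominationNumber t (generalizedPetersen n k) := by
  classical
  obtain ⟨f, hf, hw⟩ := exists_rainbowWeight_eq (generalizedPetersen n k) ht0
  have h := mul_card_le_six_mul_rainbowWeight (generalizedPetersen_isRegularOfDegree hk hkn) ht hf
  rw [hw, Fintype.card_sum, Fintype.card_fin] at h
  linarith

lemma mul_lt_three_mul_rainbowDominationNumber (hk : 1 ≤ k) (hkn : 2 * k < n) (ht0 : 0 < t)
    (ht : t < 6) (h : ¬ (Even n ∧ Odd k ∧ 3 ∣ n ∧ ¬ 3 ∣ k)) :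
    t * n < 3 * rainbowDominationNumber t (generalizedPetersen n k) := by
  classical
  refine (mul_le_three_mul_rainbowDominationNumber hk hkn ht0 ht.le).lt_of_ne fun heq => h ?_
  obtain ⟨f, hf, hw⟩ := exists_rainbowWeight_eq (generalizedPetersen n k) ht0
  have hT := isTightRainbow_of_six_mul_rainbowWeight_eq
    (generalizedPetersen_isRegularOfDegree hk hkn) ht0 ht hf (by
      rw [hw, Fintype.card_sum, Fintype.card_fin]
      linarith)
  have : NeZero n := ⟨by omega⟩
  exact ⟨hT.even_order (by omega), hT.odd_skip (by omega) hk (by omega),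
    hT.three_dvd_order hk hkn ht0, hT.not_three_dvd_skip hk hkn ht0⟩

end LowerBound

/-! ### From three classes of colors to `t` colors -/

section Placement

variable {V : Type*} {G : SimpleGraph V}

/-- A finite set `P` of pairs (vertex, class), with three classes, is a rainbow placement if each
vertex that carries no class sees all three classes in its neighborhood. It encodes a `3`-rainbow
domination function of weight `P.card`. -/
def IsRainbowPlacement (G : SimpleGraph V) (P : Finset (V × ZMod 3)) : Prop :=
  ∀ v, (∃ a, (v, a) ∈ P) ∨ ∀ a, ∃ u, G.Adj v u ∧ (u, a) ∈ P

/-- A partition of the `t` colors into three nonempty classes, used through the sizes of its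
classes. The last two fields say how cheap the classes are when a class may be chosen: over the
three cyclic relabelings, the cheaper one of two distinct classes costs at most `t - 1` in total,
and there is a class with a single color. -/
structure IsColorSplit {t : ℕ} (S : ZMod 3 → Finset (Fin t)) : Prop where
  nonempty : ∀ a, (S a).Nonempty
  cover : ∀ b, ∃ a, b ∈ S a
  sum_card : ∀ a, ∑ r, (S (a + r)).card = t
  sum_min_card : ∀ a b, a ≠ b → ∑ r, min (S (a + r)).card (S (b + r)).card + 1 ≤ t
  exists_card_eq_one : ∀ r, ∃ a, (S (a + r)).card = 1

lemma exists_isColorSplit {t : ℕ} (ht : t = 4 ∨ t = 5) :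
    ∃ S : ZMod 3 → Finset (Fin t), IsColorSplit S := by
  rcases ht with rfl | rfl
  · exact ⟨(![{0, 1}, {2}, {3}] : Fin 3 → Finset (Fin 4)),
      ⟨fun a : Fin 3 => by revert a; decide, fun b => (by revert b; decide : ∃ a : Fin 3, _),
        by decide, by decide, by decide⟩⟩
  · exact ⟨(![{0}, {1, 2}, {3, 4}] : Fin 3 → Finset (Fin 5)),
      ⟨fun a : Fin 3 => by revert a; decide, fun b => (by revert b; decide : ∃ a : Fin 3, _),
        by decide, by decide, by decide⟩⟩

variable [Fintype V] {t : ℕ} {S : ZMod 3 → Finset (Fin t)}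

lemma rainbowDominationNumber_le_sum (hS : IsColorSplit S) {P : Finset (V × ZMod 3)}
    (hP : IsRainbowPlacement G P) (r : ZMod 3) :
    rainbowDominationNumber t G ≤ ∑ p ∈ P, (S (p.2 + r)).card := by
  classical
  let f : V → Finset (Fin t) := fun v => (P.filter fun p => p.1 = v).biUnion fun p => S (p.2 + r)
  have hmem : ∀ {v a b}, (v, a) ∈ P → b ∈ S (a + r) → b ∈ f v := fun {v a b} hva hb =>
    Finset.mem_biUnion.2 ⟨(v, a), by simp [hva], hb⟩
  have hf : IsRainbowDomination G t f := by
    intro v hv b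
    rcases hP v with ⟨a, ha⟩ | h
    · obtain ⟨b', hb'⟩ := hS.nonempty (a + r)
      have := hmem ha hb'
      rw [hv] at this
      exact absurd this (Finset.notMem_empty _)
    · obtain ⟨a, ha⟩ := hS.cover b
      obtain ⟨u, hvu, hu⟩ := h (a - r)
      exact ⟨u, hvu, hmem hu (by simpa using ha)⟩
  calc rainbowDominationNumber t G ≤ rainbowWeight f := Nat.sInf_le ⟨f, hf, rfl⟩
    _ ≤ ∑ v, ∑ p ∈ P.filter (fun p => p.1 = v), (S (p.2 + r)).card :=
        Finset.sum_le_sum fun v _ => Finset.card_biUnion_le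
    _ = _ := Finset.sum_fiberwise P Prod.fst _

/-- Three placements, each used with its own cyclic relabeling of the classes, bound the domination
number by the average of their weights. -/
lemma three_mul_rainbowDominationNumber_le_sum (hS : IsColorSplit S)
    {P : ZMod 3 → Finset (V × ZMod 3)} (hP : ∀ r, IsRainbowPlacement G (P r)) :
    3 * rainbowDominationNumber t G ≤ ∑ r, ∑ p ∈ P r, (S (p.2 + r)).card := by
  calc 3 * rainbowDominationNumber t G = ∑ _r : ZMod 3, rainbowDominationNumber t G := by
        simp [ZMod.card]
    _ ≤ _ := Finset.sum_le_sum fun r _ => rainbowDominationNumber_le_sum hS (hP r) r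

lemma three_mul_rainbowDominationNumber_le (ht : t = 4 ∨ t = 5) {P : Finset (V × ZMod 3)}
    (hP : IsRainbowPlacement G P) {N : ℕ} (hN : P.card ≤ N) :
    3 * rainbowDominationNumber t G ≤ t * N := by
  obtain ⟨S, hS⟩ := exists_isColorSplit ht
  refine (three_mul_rainbowDominationNumber_le_sum hS fun _ => hP).trans ?_
  rw [Finset.sum_comm, Finset.sum_congr rfl fun p _ => hS.sum_card p.2]
  simp only [Finset.sum_const, smul_eq_mul]
  rw [mul_comm]
  exact Nat.mul_le_mul_left t hN

end Placement

/-! ### The grid pattern -/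

section Grid

lemma zmod_three_cases (b a : ZMod 3) : a = b - 1 ∨ a = b ∨ a = b + 1 := by
  revert a b
  decide

variable {n k : ℕ} [NeZero n] {P : Finset ((Fin n ⊕ Fin n) × ZMod 3)}

/-- The vertex `v` sees all three classes in its neighborhood. -/
def SeesAll (k : ℕ) (P : Finset ((Fin n ⊕ Fin n) × ZMod 3)) (v : Fin n ⊕ Fin n) : Prop :=
  ∀ a, ∃ u, (generalizedPetersen n k).Adj v u ∧ (u, a) ∈ P

lemma seesAll_outer (hn : 2 ≤ n) {z : ℤ} (b : ZMod 3)
    (hP : ∀ a, a = b - 1 ∨ a = b ∨ a = b + 1 → (outerVertex n (z - 1), a) ∈ P ∨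
      (outerVertex n (z + 1), a) ∈ P ∨ (innerVertex n z, a) ∈ P) :
    SeesAll k P (outerVertex n z) := by
  intro a
  rcases hP a (zmod_three_cases b a) with h | h | h <;>
    exact ⟨_, (outer_adj_iff hn z _).2 (by tauto), h⟩

lemma seesAll_inner (hk : 1 ≤ k) (hkn : k < n) {z : ℤ} (b : ZMod 3)
    (hP : ∀ a, a = b - 1 ∨ a = b ∨ a = b + 1 → (innerVertex n (z - k), a) ∈ P ∨
      (innerVertex n (z + k), a) ∈ P ∨ (outerVertex n z, a) ∈ P) :
    SeesAll k P (innerVertex n z) := by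
  intro a
  rcases hP a (zmod_three_cases b a) with h | h | h <;>
    exact ⟨_, (inner_adj_iff hk hkn z _).2 (by tauto), h⟩

end Grid

section GridCells

/-- The vertex `u_z`, `z = x + k * y`, of `P(ck, k)`: column `x`, row `y` of the grid. -/
def gridOuter (c k : ℕ) [NeZero (c * k)] (x y : ℤ) : Fin (c * k) ⊕ Fin (c * k) :=
  outerVertex (c * k) (x + k * y)

/-- The vertex `v_z`, `z = x + k * y`, of `P(ck, k)`: column `x`, row `y` of the grid. -/
def gridInner (c k : ℕ) [NeZero (c * k)] (x y : ℤ) : Fin (c * k) ⊕ Fin (c * k) :=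
  innerVertex (c * k) (x + k * y)

/-- The class of the cell in column `x`, row `y`. With `σ = 1` or `σ = -1` it is constant along one
of the two diagonal directions. -/
def gridClass (σ : ZMod 3) (x y : ℤ) : ZMod 3 := x + σ * y

/-- The placement that gives each cell `(x, y)`, `0 ≤ x < k`, `0 ≤ y < c`, the one class `C x y`,
at the outer vertex if `T x y` holds and at the inner vertex otherwise. -/
def cellPattern (c k : ℕ) [NeZero (c * k)] (T : ℤ → ℤ → Prop) [∀ x y, Decidable (T x y)]
    (C : ℤ → ℤ → ZMod 3) : Finset ((Fin (c * k) ⊕ Fin (c * k)) × ZMod 3) :=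
  (Finset.range k ×ˢ Finset.range c).image fun q =>
    (if T q.1 q.2 then gridOuter c k q.1 q.2 else gridInner c k q.1 q.2, C q.1 q.2)

/-- The periodic pattern: each cell carries its class, at the outer vertex if `x + y + p` is even
and at the inner vertex otherwise. -/
def gridPattern (c k : ℕ) [NeZero (c * k)] (p : ℤ) (σ : ZMod 3) :
    Finset ((Fin (c * k) ⊕ Fin (c * k)) × ZMod 3) :=
  cellPattern c k (fun x y => Even (x + y + p)) (gridClass σ)

variable {c k : ℕ} [NeZero (c * k)] {p : ℤ} {σ : ZMod 3}

lemma gridOuter_add_left (x y : ℤ) : gridOuter c k (x + k) y = gridOuter c k x (y + 1) :=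
  outerVertex_congr 0 (by push_cast; ring)

lemma gridOuter_add_right (x y : ℤ) : gridOuter c k x (y + c) = gridOuter c k x y :=
  outerVertex_congr 1 (by push_cast; ring)

lemma gridInner_add_right (x y : ℤ) : gridInner c k x (y + c) = gridInner c k x y :=
  innerVertex_congr 1 (by push_cast; ring)

section CellPattern

variable {T : ℤ → ℤ → Prop} [∀ x y, Decidable (T x y)] {C : ℤ → ℤ → ZMod 3}

lemma card_cellPattern_le : (cellPattern c k T C).card ≤ c * k := by
  refine Finset.card_image_le.trans ?_
  simp [mul_comm]

lemma outer_mem_cellPattern {x y : ℤ} (hx : 0 ≤ x) (hxk : x < k) (hy : 0 ≤ y) (hyc : y < c)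
    (h : T x y) : (gridOuter c k x y, C x y) ∈ cellPattern c k T C := by
  lift x to ℕ using hx
  lift y to ℕ using hy
  refine Finset.mem_image.2 ⟨(x, y), ?_, ?_⟩
  · simp only [Finset.mem_product, Finset.mem_range]
    omega
  · simp only [if_pos h]

lemma inner_mem_cellPattern {x y : ℤ} (hx : 0 ≤ x) (hxk : x < k) (hy : 0 ≤ y) (hyc : y < c)
    (h : ¬ T x y) : (gridInner c k x y, C x y) ∈ cellPattern c k T C := by
  lift x to ℕ using hx
  lift y to ℕ using hy
  refine Finset.mem_image.2 ⟨(x, y), ?_, ?_⟩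
  · simp only [Finset.mem_product, Finset.mem_range]
    omega
  · simp only [if_neg h]

end CellPattern

lemma card_gridPattern_le : (gridPattern c k p σ).card ≤ c * k :=
  card_cellPattern_le

lemma outer_mem_gridPattern {x y : ℤ} (hx : 0 ≤ x) (hxk : x < k) (hy : 0 ≤ y) (hyc : y < c)
    (h : Even (x + y + p)) : (gridOuter c k x y, gridClass σ x y) ∈ gridPattern c k p σ :=
  outer_mem_cellPattern (T := fun x y => Even (x + y + p)) hx hxk hy hyc h

lemma inner_mem_gridPattern {x y : ℤ} (hx : 0 ≤ x) (hxk : x < k) (hy : 0 ≤ y) (hyc : y < c)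
    (h : Odd (x + y + p)) : (gridInner c k x y, gridClass σ x y) ∈ gridPattern c k p σ :=
  inner_mem_cellPattern (T := fun x y => Even (x + y + p)) hx hxk hy hyc
    (Int.not_even_iff_odd.2 h)

lemma exists_grid_coordinates (z : ℤ) : ∃ x y m : ℤ, 0 ≤ x ∧ x < k ∧ 0 ≤ y ∧ y < c ∧
    z = x + k * y + (c * k : ℕ) * m := by
  have hck : 0 < c * k := NeZero.pos _
  have hk : (0 : ℤ) < k := by exact_mod_cast Nat.pos_of_mul_pos_left hck
  have hc : (0 : ℤ) < c := by exact_mod_cast Nat.pos_of_mul_pos_right hck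
  refine ⟨z % k, z / k % c, z / k / c, Int.emod_nonneg _ hk.ne', Int.emod_lt_of_pos _ hk,
    Int.emod_nonneg _ hc.ne', Int.emod_lt_of_pos _ hc, ?_⟩
  have h1 := Int.emod_add_mul_ediv z k
  have h2 := Int.emod_add_mul_ediv (z / k) c
  push_cast
  linear_combination -h1 - k * h2

/-- To check a placement on `P(ck, k)` it suffices to check each cell of the grid. -/
lemma isRainbowPlacement_of_cells {P : Finset ((Fin (c * k) ⊕ Fin (c * k)) × ZMod 3)}
    (h : ∀ x y : ℤ, 0 ≤ x → x < k → 0 ≤ y → y < c →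
      ((∃ a, (gridOuter c k x y, a) ∈ P) ∨ SeesAll k P (gridOuter c k x y)) ∧
      ((∃ a, (gridInner c k x y, a) ∈ P) ∨ SeesAll k P (gridInner c k x y))) :
    IsRainbowPlacement (generalizedPetersen (c * k) k) P := by
  intro v
  rcases vertex_cases v with ⟨z, rfl⟩ | ⟨z, rfl⟩
  · obtain ⟨x, y, m, h1, h2, h3, h4, h5⟩ := exists_grid_coordinates (c := c) (k := k) z
    have := (h x y h1 h2 h3 h4).1
    rwa [gridOuter, ← outerVertex_congr m h5] at this
  · obtain ⟨x, y, m, h1, h2, h3, h4, h5⟩ := exists_grid_coordinates (c := c) (k := k) z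
    have := (h x y h1 h2 h3 h4).2
    rwa [gridInner, ← innerVertex_congr m h5] at this

variable {P : Finset ((Fin (c * k) ⊕ Fin (c * k)) × ZMod 3)}

lemma seesAll_gridOuter (hn : 2 ≤ c * k) {x y : ℤ} (b : ZMod 3)
    (hP : ∀ a, a = b - 1 ∨ a = b ∨ a = b + 1 → (gridOuter c k (x - 1) y, a) ∈ P ∨
      (gridOuter c k (x + 1) y, a) ∈ P ∨ (gridInner c k x y, a) ∈ P) :
    SeesAll k P (gridOuter c k x y) := by
  refine seesAll_outer hn b fun a ha => ?_
  have := hP a ha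
  rwa [gridOuter, gridOuter, gridInner, show x - 1 + k * y = x + k * y - 1 by ring,
    show x + 1 + k * y = x + k * y + 1 by ring] at this

lemma seesAll_gridInner (hk : 1 ≤ k) (hkn : k < c * k) {x y : ℤ} (b : ZMod 3)
    (hP : ∀ a, a = b - 1 ∨ a = b ∨ a = b + 1 → (gridInner c k x (y - 1), a) ∈ P ∨
      (gridInner c k x (y + 1), a) ∈ P ∨ (gridOuter c k x y, a) ∈ P) :
    SeesAll k P (gridInner c k x y) := by
  refine seesAll_inner hk hkn b fun a ha => ?_
  have := hP a ha
  rwa [gridInner, gridInner, gridOuter, show x + k * (y - 1) = x + k * y - k by ring,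
    show x + k * (y + 1) = x + k * y + k by ring] at this

/-- In the interior of the grid the pattern shows three distinct classes to each vertex without
a class. A placement containing the pattern therefore only has to be checked along the two seams,
where the grid is glued to itself. -/
lemma isRainbowPlacement_of_seams (hk : 1 ≤ k) (hc : 3 ≤ c) (hσ : σ = 1 ∨ σ = -1)
    (hP : gridPattern c k p σ ⊆ P)
    (hL : ∀ y : ℤ, 0 ≤ y → y < c → Odd (y + p) →
      (∃ a, (gridOuter c k 0 y, a) ∈ P) ∨ (gridOuter c k (-1) y, gridClass σ (-1) y) ∈ P)
    (hR : ∀ y : ℤ, 0 ≤ y → y < c → Odd (k - 1 + y + p) →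
      (∃ a, (gridOuter c k (k - 1) y, a) ∈ P) ∨ (gridOuter c k k y, gridClass σ k y) ∈ P)
    (hD : ∀ x : ℤ, 0 ≤ x → x < k → Even (x + p) →
      (∃ a, (gridInner c k x 0, a) ∈ P) ∨ (gridInner c k x (-1), gridClass σ x (-1)) ∈ P)
    (hU : ∀ x : ℤ, 0 ≤ x → x < k → Even (x + (c - 1) + p) →
      (∃ a, (gridInner c k x (c - 1), a) ∈ P) ∨ (gridInner c k x c, gridClass σ x c) ∈ P) :
    IsRainbowPlacement (generalizedPetersen (c * k) k) P := by
  have hkn : k < c * k := by nlinarith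
  refine isRainbowPlacement_of_cells fun x y hx hxk hy hyc => ⟨?_, ?_⟩
  · by_cases hp : Even (x + y + p)
    · exact Or.inl ⟨_, hP (outer_mem_gridPattern hx hxk hy hyc hp)⟩
    rw [Int.not_even_iff_odd] at hp
    have hin := hP (inner_mem_gridPattern (σ := σ) hx hxk hy hyc hp)
    have hl : (∃ a, (gridOuter c k x y, a) ∈ P) ∨
        (gridOuter c k (x - 1) y, gridClass σ (x - 1) y) ∈ P := by
      rcases hx.eq_or_lt with rfl | hx0
      · simpa using hL y hy hyc (by simpa using hp)
      · exact Or.inr (hP (outer_mem_gridPattern (by omega) (by omega) hy hyc (by grind)))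
    have hr : (∃ a, (gridOuter c k x y, a) ∈ P) ∨
        (gridOuter c k (x + 1) y, gridClass σ (x + 1) y) ∈ P := by
      rcases (show x ≤ k - 1 by omega).eq_or_lt with rfl | hx0
      · simpa using hR y hy hyc hp
      · exact Or.inr (hP (outer_mem_gridPattern (by omega) (by omega) hy hyc (by grind)))
    rcases hl with hl | hl
    · exact Or.inl hl
    rcases hr with hr | hr
    · exact Or.inl hr
    refine Or.inr (seesAll_gridOuter (by omega) (gridClass σ x y) fun a ha => ?_)
    have e1 : gridClass σ (x - 1) y = gridClass σ x y - 1 := by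
      simp only [gridClass]; push_cast; ring
    have e2 : gridClass σ (x + 1) y = gridClass σ x y + 1 := by
      simp only [gridClass]; push_cast; ring
    rw [e1] at hl
    rw [e2] at hr
    rcases ha with rfl | rfl | rfl <;> tauto
  · by_cases hp : Odd (x + y + p)
    · exact Or.inl ⟨_, hP (inner_mem_gridPattern hx hxk hy hyc hp)⟩
    rw [Int.not_odd_iff_even] at hp
    have hout := hP (outer_mem_gridPattern (σ := σ) hx hxk hy hyc hp)
    have hd : (∃ a, (gridInner c k x y, a) ∈ P) ∨
        (gridInner c k x (y - 1), gridClass σ x (y - 1)) ∈ P := by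
      rcases hy.eq_or_lt with rfl | hy0
      · simpa using hD x hx hxk (by simpa using hp)
      · exact Or.inr (hP (inner_mem_gridPattern hx hxk (by omega) (by omega) (by grind)))
    have hu : (∃ a, (gridInner c k x y, a) ∈ P) ∨
        (gridInner c k x (y + 1), gridClass σ x (y + 1)) ∈ P := by
      rcases (show y ≤ c - 1 by omega).eq_or_lt with rfl | hy0
      · simpa using hU x hx hxk hp
      · exact Or.inr (hP (inner_mem_gridPattern hx hxk (by omega) (by omega) (by grind)))
    rcases hd with hd | hd
    · exact Or.inl hd
    rcases hu with hu | hu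
    · exact Or.inl hu
    refine Or.inr (seesAll_gridInner hk hkn (gridClass σ x y) fun a ha => ?_)
    have e1 : gridClass σ x (y - 1) = gridClass σ x y - σ := by
      simp only [gridClass]; push_cast; ring
    have e2 : gridClass σ x (y + 1) = gridClass σ x y + σ := by
      simp only [gridClass]; push_cast; ring
    rw [e1] at hd
    rw [e2] at hu
    rcases hσ with rfl | rfl
    · rcases ha with rfl | rfl | rfl <;> tauto
    · rw [sub_neg_eq_add] at hd
      rw [← sub_eq_add_neg] at hu
      rcases ha with rfl | rfl | rfl <;> tauto

end GridCells

/-! ### Repairing the seams -/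

section Repairs

variable {c k : ℕ} [NeZero (c * k)] {p : ℤ} {σ : ZMod 3}

lemma gridOuter_neg_one (y : ℤ) : gridOuter c k (-1) y = gridOuter c k (k - 1) (y - 1) := by
  have := gridOuter_add_left (c := c) (k := k) (-1) (y - 1)
  rw [sub_add_cancel] at this
  rw [← this, neg_add_eq_sub]

lemma gridOuter_skip (y : ℤ) : gridOuter c k k y = gridOuter c k 0 (y + 1) := by
  simpa using gridOuter_add_left (c := c) (k := k) 0 y

lemma gridOuter_zero_order : gridOuter c k 0 c = gridOuter c k 0 0 := by
  simpa using gridOuter_add_right (c := c) (k := k) 0 0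

lemma gridOuter_neg_one_zero : gridOuter c k (-1) 0 = gridOuter c k (k - 1) (c - 1) := by
  rw [gridOuter_neg_one, ← gridOuter_add_right, zero_sub, neg_add_eq_sub]

lemma gridInner_neg_one (x : ℤ) : gridInner c k x (-1) = gridInner c k x (c - 1) := by
  rw [← gridInner_add_right, neg_add_eq_sub]

lemma gridInner_order (x : ℤ) : gridInner c k x c = gridInner c k x 0 := by
  simpa using gridInner_add_right (c := c) (k := k) x 0

/-- Across the seam between the last and the first column, in the case `k` even, two vertices
without a class meet in every second row. Filling one of them with the class that the other one
misses satisfies both. -/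
def columnFill (c k : ℕ) [NeZero (c * k)] (σ : ZMod 3) (m : ℕ) :
    Finset ((Fin (c * k) ⊕ Fin (c * k)) × ZMod 3) :=
  (Finset.range m).image fun j : ℕ =>
    (gridOuter c k (k - 1) (2 * j), gridClass σ (-1) (2 * j + 1))

/-- The analogue of `columnFill` for the seam between the last and the first row, when `c` is odd.
-/
def rowFill (c k : ℕ) [NeZero (c * k)] (p : ℤ) (σ : ZMod 3) (m : ℕ) :
    Finset ((Fin (c * k) ⊕ Fin (c * k)) × ZMod 3) :=
  (Finset.range m).image fun j : ℕ => (gridInner c k (2 * j + p) 0, gridClass σ (2 * j + p) c)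

/-- Across the seam between the last and the first column, in the case `k` odd, a vertex without
a class meets a vertex with a class in each row. The class wanted by the former is added to the
latter. -/
def columnAdd (c k : ℕ) [NeZero (c * k)] (p : ℤ) (σ : ZMod 3) (m : ℕ) :
    Finset ((Fin (c * k) ⊕ Fin (c * k)) × ZMod 3) :=
  (Finset.range m).image fun y : ℕ =>
    if Even ((y : ℤ) + p) then (gridOuter c k (k - 1) y, gridClass σ (-1) (y + 1))
    else (gridOuter c k 0 (y + 1), gridClass σ k y)

/-- The analogue of `columnAdd` for the seam between the last and the first row, when `c` is even.
-/
def rowAdd (c k : ℕ) [NeZero (c * k)] (σ : ZMod 3) :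
    Finset ((Fin (c * k) ⊕ Fin (c * k)) × ZMod 3) :=
  (Finset.range k).image fun x : ℕ =>
    if Even (x : ℤ) then (gridInner c k x (c - 1), gridClass σ x (-1))
    else (gridInner c k x 0, gridClass σ x c)

lemma card_columnFill_le (m : ℕ) : (columnFill c k σ m).card ≤ m :=
  Finset.card_image_le.trans (by simp)

lemma card_rowFill_le (m : ℕ) : (rowFill c k p σ m).card ≤ m :=
  Finset.card_image_le.trans (by simp)

lemma card_columnAdd_le (m : ℕ) : (columnAdd c k p σ m).card ≤ m :=
  Finset.card_image_le.trans (by simp)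

lemma card_rowAdd_le : (rowAdd c k σ).card ≤ k :=
  Finset.card_image_le.trans (by simp)

lemma columnFill_right {m : ℕ} {y : ℤ} (hy : 0 ≤ y) (hym : y < 2 * m) (h : Even y) :
    (gridOuter c k (k - 1) y, gridClass σ (-1) (y + 1)) ∈ columnFill c k σ m := by
  obtain ⟨j, rfl⟩ := even_iff_two_dvd.1 h
  lift j to ℕ using by omega
  exact Finset.mem_image.2 ⟨j, Finset.mem_range.2 (by omega), rfl⟩

lemma columnFill_left {m : ℕ} {y : ℤ} (hy : 0 ≤ y) (hym : y ≤ 2 * m) (h : Odd y) :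
    (gridOuter c k (-1) y, gridClass σ (-1) y) ∈ columnFill c k σ m := by
  have := columnFill_right (c := c) (k := k) (σ := σ) (m := m) (y := y - 1) (by grind) (by grind)
    (by grind)
  rwa [sub_add_cancel, ← gridOuter_neg_one] at this

lemma rowFill_up {m : ℕ} {x : ℤ} (hp : p = 0 ∨ p = 1) (hx : 0 ≤ x) (hxm : x < 2 * m + p)
    (h : Even (x + p)) : (gridInner c k x c, gridClass σ x c) ∈ rowFill c k p σ m := by
  obtain ⟨j, rfl⟩ : ∃ j, x = 2 * j + p := ⟨(x - p) / 2, by grind⟩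
  lift j to ℕ using by omega
  rw [gridInner_order]
  exact Finset.mem_image.2 ⟨j, Finset.mem_range.2 (by omega), rfl⟩

lemma rowFill_down {m : ℕ} {x : ℤ} (hp : p = 0 ∨ p = 1) (hx : 0 ≤ x) (hxm : x < 2 * m + p)
    (h : Even (x + p)) : (gridInner c k x 0, gridClass σ x c) ∈ rowFill c k p σ m := by
  rw [← gridInner_order]
  exact rowFill_up hp hx hxm h

lemma columnAdd_right {m : ℕ} {y : ℤ} (hy : 0 ≤ y) (hym : y < m) (h : Odd (y + p)) :
    (gridOuter c k k y, gridClass σ k y) ∈ columnAdd c k p σ m := by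
  lift y to ℕ using hy
  refine Finset.mem_image.2 ⟨y, Finset.mem_range.2 (by omega), ?_⟩
  rw [if_neg (Int.not_even_iff_odd.2 h), gridOuter_skip]

lemma columnAdd_left {m : ℕ} {y : ℤ} (hy : 0 < y) (hym : y ≤ m) (h : Odd (y + p)) :
    (gridOuter c k (-1) y, gridClass σ (-1) y) ∈ columnAdd c k p σ m := by
  obtain ⟨j, rfl⟩ : ∃ j : ℕ, y = j + 1 := ⟨(y - 1).toNat, by omega⟩
  refine Finset.mem_image.2 ⟨j, Finset.mem_range.2 (by omega), ?_⟩
  rw [if_pos (by grind), gridOuter_neg_one, add_sub_cancel_right]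

lemma rowAdd_down {x : ℤ} (hx : 0 ≤ x) (hxk : x < k) (h : Even x) :
    (gridInner c k x (-1), gridClass σ x (-1)) ∈ rowAdd c k σ := by
  lift x to ℕ using hx
  refine Finset.mem_image.2 ⟨x, Finset.mem_range.2 (by omega), ?_⟩
  rw [if_pos h, gridInner_neg_one]

lemma rowAdd_up {x : ℤ} (hx : 0 ≤ x) (hxk : x < k) (h : Odd x) :
    (gridInner c k x c, gridClass σ x c) ∈ rowAdd c k σ := by
  lift x to ℕ using hx
  refine Finset.mem_image.2 ⟨x, Finset.mem_range.2 (by omega), ?_⟩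
  rw [if_neg (Int.not_even_iff_odd.2 h), gridInner_order]

/-- If `k` is odd and `k = σ` modulo `3`, the pattern continues across the seam between the
columns. -/
lemma gridPattern_right (hk : Odd k) (hσ : (k : ZMod 3) = σ) {y : ℤ} (hy : 0 ≤ y) (hyc : y < c - 1)
    (h : Odd (y + p)) : (gridOuter c k k y, gridClass σ k y) ∈ gridPattern c k p σ := by
  have hk' := hk.pos
  rw [gridOuter_skip, show gridClass σ k y = gridClass σ 0 (y + 1) by
    simp only [gridClass]; push_cast; rw [hσ]; ring]
  exact outer_mem_gridPattern le_rfl (by omega) (by omega) (by omega) (by grind)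

lemma gridPattern_left (hk : Odd k) (hσ : (k : ZMod 3) = σ) {y : ℤ} (hy : 0 < y) (hyc : y < c)
    (h : Odd (y + p)) : (gridOuter c k (-1) y, gridClass σ (-1) y) ∈ gridPattern c k p σ := by
  have hk' := hk.pos
  rw [gridOuter_neg_one, show gridClass σ (-1) y = gridClass σ (k - 1) (y - 1) by
    simp only [gridClass]; push_cast; rw [hσ]; ring]
  refine outer_mem_gridPattern (by omega) (by omega) (by omega) (by omega) ?_
  have : Odd (k : ℤ) := by exact_mod_cast hk
  grind

/-- If `3 ∣ c`, the pattern continues across the seam between the rows. -/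
lemma gridPattern_up (hc0 : (c : ZMod 3) = 0) (hc1 : 0 < c) {x : ℤ} (hx : 0 ≤ x)
    (hxk : x < k) (h : Odd (x + p)) :
    (gridInner c k x c, gridClass σ x c) ∈ gridPattern c k p σ := by
  rw [gridInner_order, show gridClass σ x c = gridClass σ x 0 by
    simp only [gridClass]; push_cast; rw [hc0]]
  exact inner_mem_gridPattern hx hxk le_rfl (by omega) (by grind)

/-- If `6 ∣ c`, the pattern continues across the seam between the rows in the other direction too.
-/
lemma gridPattern_down (hc : Even c) (hc0 : (c : ZMod 3) = 0) (hc1 : 0 < c) {x : ℤ} (hx : 0 ≤ x)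
    (hxk : x < k) (h : Even (x + p)) :
    (gridInner c k x (-1), gridClass σ x (-1)) ∈ gridPattern c k p σ := by
  rw [gridInner_neg_one, show gridClass σ x (-1) = gridClass σ x (c - 1) by
    simp only [gridClass]; push_cast; rw [hc0]; ring]
  refine inner_mem_gridPattern hx hxk (by omega) (by omega) ?_
  have : Even (c : ℤ) := by exact_mod_cast hc
  grind

end Repairs

/-! ### Placements with repaired seams -/

section Placements

variable {c k : ℕ} [NeZero (c * k)] {σ : ZMod 3}

lemma card_union_le_add {α : Type*} [DecidableEq α] {s t : Finset α} {a b : ℕ} (hs : s.card ≤ a)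
    (ht : t.card ≤ b) : (s ∪ t).card ≤ a + b :=
  (Finset.card_union_le s t).trans (add_le_add hs ht)

/-- The pattern closes up perfectly. -/
lemma exists_placement_even_order (hk : 1 ≤ k) (hc : 3 ≤ c) (hce : Even c)
    (hc0 : (c : ZMod 3) = 0) (hko : Odd k) (hσ : σ = 1 ∨ σ = -1) (hkσ : (k : ZMod 3) = σ) :
    ∃ P, IsRainbowPlacement (generalizedPetersen (c * k) k) P ∧ P.card ≤ c * k := by
  refine ⟨gridPattern c k 0 σ, isRainbowPlacement_of_seams hk hc hσ subset_rfl
    (fun y hy hyc h => Or.inr ?_) (fun y hy hyc h => Or.inr ?_) (fun x hx hxk h => Or.inr ?_)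
    (fun x hx hxk h => Or.inr ?_), card_gridPattern_le⟩
  · exact gridPattern_left hko hkσ (by grind) hyc h
  · have hko' : Odd (k : ℤ) := by exact_mod_cast hko
    rcases (show y ≤ c - 1 by omega).eq_or_lt with rfl | hy'
    · rw [gridOuter_skip, sub_add_cancel, gridOuter_zero_order,
        show gridClass σ k (c - 1) = gridClass σ 0 0 by
          simp only [gridClass]; push_cast; rw [hkσ, hc0]; ring]
      exact outer_mem_gridPattern le_rfl (by omega) le_rfl (by omega) (by simp)
    · exact gridPattern_right hko hkσ hy hy' (by grind)
  · exact gridPattern_down hce hc0 (by omega) hx hxk h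
  · have hce' : Even (c : ℤ) := by exact_mod_cast hce
    exact gridPattern_up hc0 (by omega) hx hxk (by grind)

lemma exists_placement_six_dvd_of_even (hk : 1 ≤ k) (hc : 3 ≤ c) (hce : Even c)
    (hc0 : (c : ZMod 3) = 0) (hke : Even k) :
    ∃ P, IsRainbowPlacement (generalizedPetersen (c * k) k) P ∧ P.card ≤ c * k + c / 2 := by
  have hce' : Even (c : ℤ) := by exact_mod_cast hce
  have hke' : Even (k : ℤ) := by exact_mod_cast hke
  refine ⟨gridPattern c k 0 1 ∪ columnFill c k 1 (c / 2),
    isRainbowPlacement_of_seams hk hc (Or.inl rfl) Finset.subset_union_left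
    (fun y hy hyc h => Or.inr ?_) (fun y hy hyc h => Or.inl ?_) (fun x hx hxk h => Or.inr ?_)
    (fun x hx hxk h => Or.inr ?_), card_union_le_add card_gridPattern_le (card_columnFill_le _)⟩
  · exact Finset.mem_union_right _ (columnFill_left hy (by grind) (by grind))
  · exact ⟨_, Finset.mem_union_right _ (columnFill_right hy (by grind) (by grind))⟩
  · exact Finset.mem_union_left _ (gridPattern_down hce hc0 (by omega) hx hxk h)
  · exact Finset.mem_union_left _ (gridPattern_up hc0 (by omega) hx hxk (by grind))

lemma exists_placement_six_dvd_of_odd (hk : 1 ≤ k) (hc : 3 ≤ c) (hce : Even c)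
    (hc0 : (c : ZMod 3) = 0) (hko : Odd k) :
    ∃ P, IsRainbowPlacement (generalizedPetersen (c * k) k) P ∧ P.card ≤ c * k + c := by
  have hce' : Even (c : ℤ) := by exact_mod_cast hce
  have hko' : Odd (k : ℤ) := by exact_mod_cast hko
  refine ⟨gridPattern c k 0 1 ∪ columnAdd c k 0 1 c,
    isRainbowPlacement_of_seams hk hc (Or.inl rfl) Finset.subset_union_left
    (fun y hy hyc h => Or.inr ?_) (fun y hy hyc h => Or.inr ?_) (fun x hx hxk h => Or.inr ?_)
    (fun x hx hxk h => Or.inr ?_), card_union_le_add card_gridPattern_le (card_columnAdd_le _)⟩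
  · exact Finset.mem_union_right _ (columnAdd_left (by grind) (by grind) (by grind))
  · exact Finset.mem_union_right _ (columnAdd_right hy (by grind) (by grind))
  · exact Finset.mem_union_left _ (gridPattern_down hce hc0 (by omega) hx hxk h)
  · exact Finset.mem_union_left _ (gridPattern_up hc0 (by omega) hx hxk (by grind))

lemma exists_placement_odd_odd (hk : 1 ≤ k) (hc : 3 ≤ c) (hco : Odd c)
    (hko : Odd k) (hσ : σ = 1 ∨ σ = -1) (hkσ : (k : ZMod 3) = σ) :
    ∃ P, IsRainbowPlacement (generalizedPetersen (c * k) k) P ∧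
      P.card ≤ c * k + (k + 1) / 2 := by
  have hco' : Odd (c : ℤ) := by exact_mod_cast hco
  have hko' : Odd (k : ℤ) := by exact_mod_cast hko
  refine ⟨gridPattern c k 0 σ ∪ rowFill c k 0 σ ((k + 1) / 2),
    isRainbowPlacement_of_seams hk hc hσ Finset.subset_union_left
    (fun y hy hyc h => Or.inr ?_) (fun y hy hyc h => Or.inr ?_)
    (fun x hx hxk h => Or.inl ?_)
    (fun x hx hxk h => Or.inr ?_), card_union_le_add card_gridPattern_le (card_rowFill_le _)⟩
  · exact Finset.mem_union_left _ (gridPattern_left hko hkσ (by grind) hyc h)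
  · exact Finset.mem_union_left _ (gridPattern_right hko hkσ hy (by grind) (by grind))
  · exact ⟨_, Finset.mem_union_right _ (rowFill_down (Or.inl rfl) hx (by grind) h)⟩
  · exact Finset.mem_union_right _ (rowFill_up (Or.inl rfl) hx (by grind) (by grind))

/-- With the parity offset `1`, the `c - 1` inner places of the column seam and the `(k - 1) / 2`
places of the row seam are repaired, and one class more at the vertex shared by the two ends of the
column seam repairs the corner. -/
lemma exists_placement_odd_of_odd (hk : 1 ≤ k) (hc : 3 ≤ c) (hco : Odd c) (hko : Odd k) :
    ∃ P, IsRainbowPlacement (generalizedPetersen (c * k) k) P ∧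
      P.card ≤ c * k + (c - 1) + (k - 1) / 2 + 1 := by
  have hco' : Odd (c : ℤ) := by exact_mod_cast hco
  have hko' : Odd (k : ℤ) := by exact_mod_cast hko
  refine ⟨gridPattern c k 1 1 ∪ columnAdd c k 1 1 (c - 1) ∪ rowFill c k 1 1 ((k - 1) / 2) ∪
      {(gridOuter c k (-1) 0, gridClass 1 (-1) 0)},
    isRainbowPlacement_of_seams hk hc (Or.inl rfl)
      (fun _ h => Finset.mem_union_left _ (Finset.mem_union_left _ (Finset.mem_union_left _ h)))
    (fun y hy hyc h => Or.inr ?_) (fun y hy hyc h => ?_) (fun x hx hxk h => Or.inl ?_)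
    (fun x hx hxk h => Or.inr ?_), card_union_le_add (card_union_le_add (card_union_le_add
      card_gridPattern_le (card_columnAdd_le _)) (card_rowFill_le _)) (Finset.card_singleton _).le⟩
  · rcases hy.eq_or_lt with rfl | hy'
    · exact Finset.mem_union_right _ (Finset.mem_singleton_self _)
    · exact Finset.mem_union_left _ (Finset.mem_union_left _ (Finset.mem_union_right _
        (columnAdd_left hy' (by omega) h)))
  · rcases (show y ≤ c - 1 by omega).eq_or_lt with rfl | hy'
    · rw [← gridOuter_neg_one_zero]
      exact Or.inl ⟨_, Finset.mem_union_right _ (Finset.mem_singleton_self _)⟩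
    · exact Or.inr (Finset.mem_union_left _ (Finset.mem_union_left _ (Finset.mem_union_right _
        (columnAdd_right hy (by omega) (by grind)))))
  · exact ⟨_, Finset.mem_union_left _ (Finset.mem_union_right _
      (rowFill_down (Or.inr rfl) hx (by grind) h))⟩
  · exact Finset.mem_union_left _ (Finset.mem_union_right _
      (rowFill_up (Or.inr rfl) hx (by grind) (by grind)))

lemma exists_placement_even_odd (hk : 1 ≤ k) (hc : 3 ≤ c) (hce : Even c)
    (hko : Odd k) (hσ : σ = 1 ∨ σ = -1) (hkσ : (k : ZMod 3) = σ) :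
    ∃ P, IsRainbowPlacement (generalizedPetersen (c * k) k) P ∧ P.card ≤ c * k + k + 1 := by
  have hce' : Even (c : ℤ) := by exact_mod_cast hce
  have hko' : Odd (k : ℤ) := by exact_mod_cast hko
  refine ⟨gridPattern c k 0 σ ∪ rowAdd c k σ ∪ {(gridOuter c k k (c - 1), gridClass σ k (c - 1))},
    isRainbowPlacement_of_seams hk hc hσ
      (fun _ h => Finset.mem_union_left _ (Finset.mem_union_left _ h))
    (fun y hy hyc h => Or.inr ?_) (fun y hy hyc h => Or.inr ?_) (fun x hx hxk h => Or.inr ?_)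
    (fun x hx hxk h => Or.inr ?_), card_union_le_add (card_union_le_add
      card_gridPattern_le card_rowAdd_le) (Finset.card_singleton _).le⟩
  · exact Finset.mem_union_left _ (Finset.mem_union_left _
      (gridPattern_left hko hkσ (by grind) hyc h))
  · rcases (show y ≤ c - 1 by omega).eq_or_lt with rfl | hy'
    · exact Finset.mem_union_right _ (Finset.mem_singleton_self _)
    · exact Finset.mem_union_left _ (Finset.mem_union_left _
        (gridPattern_right hko hkσ hy hy' (by grind)))
  · exact Finset.mem_union_left _ (Finset.mem_union_right _ (rowAdd_down hx hxk (by grind)))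
  · exact Finset.mem_union_left _ (Finset.mem_union_right _ (rowAdd_up hx hxk (by grind)))

lemma exists_placement_even_even (hk : 1 ≤ k) (hc : 3 ≤ c) (hce : Even c) (hke : Even k) :
    ∃ P, IsRainbowPlacement (generalizedPetersen (c * k) k) P ∧ P.card ≤ c * k + c / 2 + k := by
  have hce' : Even (c : ℤ) := by exact_mod_cast hce
  have hke' : Even (k : ℤ) := by exact_mod_cast hke
  refine ⟨gridPattern c k 0 1 ∪ columnFill c k 1 (c / 2) ∪ rowAdd c k 1,
    isRainbowPlacement_of_seams hk hc (Or.inl rfl)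
      (fun _ h => Finset.mem_union_left _ (Finset.mem_union_left _ h))
    (fun y hy hyc h => Or.inr ?_) (fun y hy hyc h => Or.inl ?_) (fun x hx hxk h => Or.inr ?_)
    (fun x hx hxk h => Or.inr ?_), card_union_le_add (card_union_le_add
      card_gridPattern_le (card_columnFill_le _)) card_rowAdd_le⟩
  · exact Finset.mem_union_left _ (Finset.mem_union_right _
      (columnFill_left hy (by grind) (by grind)))
  · exact ⟨_, Finset.mem_union_left _ (Finset.mem_union_right _
      (columnFill_right hy (by grind) (by grind)))⟩
  · exact Finset.mem_union_right _ (rowAdd_down hx hxk (by grind))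
  · exact Finset.mem_union_right _ (rowAdd_up hx hxk (by grind))

end Placements

/-! ### Repairs with a choice -/

section Choice

variable {V : Type*}

lemma sum_sum_min_le {t : ℕ} {S : ZMod 3 → Finset (Fin t)} (m b : ℕ) (f g : ℕ → V × ZMod 3)
    (h : ∀ j, ∑ r, min (S ((f j).2 + r)).card (S ((g j).2 + r)).card ≤ b) :
    ∑ r, ∑ j ∈ Finset.range m, min (S ((f j).2 + r)).card (S ((g j).2 + r)).card ≤ m * b := by
  rw [Finset.sum_comm]
  exact (Finset.sum_le_sum fun j _ => h j).trans (by simp)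

variable [DecidableEq V] {w : ZMod 3 → ℕ}

/-- For each `j < m`, the cheaper one of the two placed classes `f j` and `g j`, where `w` is the
cost of a class. -/
def cheaperChoice (w : ZMod 3 → ℕ) (m : ℕ) (f g : ℕ → V × ZMod 3) : Finset (V × ZMod 3) :=
  (Finset.range m).image fun j => if w (f j).2 ≤ w (g j).2 then f j else g j

lemma mem_cheaperChoice (w : ZMod 3 → ℕ) {m j : ℕ} (hj : j < m) (f g : ℕ → V × ZMod 3) :
    f j ∈ cheaperChoice w m f g ∨ g j ∈ cheaperChoice w m f g := by
  have h := Finset.mem_image_of_mem (fun j => if w (f j).2 ≤ w (g j).2 then f j else g j)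
    (Finset.mem_range.2 hj)
  split_ifs at h
  · exact Or.inl h
  · exact Or.inr h

lemma sum_cheaperChoice_le (m : ℕ) (f g : ℕ → V × ZMod 3) :
    ∑ p ∈ cheaperChoice w m f g, w p.2 ≤ ∑ j ∈ Finset.range m, min (w (f j).2) (w (g j).2) := by
  refine (Finset.sum_image_le_of_nonneg fun _ _ => Nat.zero_le _).trans
    (Finset.sum_le_sum fun j _ => ?_)
  split_ifs with h
  · exact (min_eq_left h).ge
  · exact (min_eq_right (not_le.1 h).le).ge

lemma sum_union_le_add {s t : Finset (V × ZMod 3)} {a b : ℕ} (hs : ∑ p ∈ s, w p.2 ≤ a)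
    (ht : ∑ p ∈ t, w p.2 ≤ b) : ∑ p ∈ s ∪ t, w p.2 ≤ a + b := by
  have := Finset.sum_union_inter (s₁ := s) (s₂ := t) (f := fun p => w p.2)
  omega

end Choice

section OddEven

variable {c k : ℕ} [NeZero (c * k)] {σ : ZMod 3}

/-- For odd `c` and even `k`, pairs of vertices without a class meet at every second place of both
seams, and filling either vertex of a pair suffices (`hA`, `hB`). One vertex at the corner remains,
`hC`. -/
lemma isRainbowPlacement_odd_even {P : Finset ((Fin (c * k) ⊕ Fin (c * k)) × ZMod 3)}
    (hk : 1 ≤ k) (hc : 3 ≤ c) (hco : Odd c) (hke : Even k) (hσ : σ = 1 ∨ σ = -1)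
    (hP : gridPattern c k 0 σ ⊆ P)
    (hA : ∀ j < (c - 1) / 2, (gridOuter c k (k - 1) (2 * j), gridClass σ (-1) (2 * j + 1)) ∈ P ∨
      (gridOuter c k 0 (2 * j + 1), gridClass σ k (2 * j)) ∈ P)
    (hB : ∀ j < k / 2, (gridInner c k (2 * j) 0, gridClass σ (2 * j) c) ∈ P ∨
      (gridInner c k (2 * j) (c - 1), gridClass σ (2 * j) (-1)) ∈ P)
    (hC : (∃ a, (gridOuter c k (k - 1) (c - 1), a) ∈ P) ∨
      (gridOuter c k k (c - 1), gridClass σ k (c - 1)) ∈ P) :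
    IsRainbowPlacement (generalizedPetersen (c * k) k) P := by
  have hco' : Odd (c : ℤ) := by exact_mod_cast hco
  have hke' : Even (k : ℤ) := by exact_mod_cast hke
  refine isRainbowPlacement_of_seams hk hc hσ hP (fun y hy hyc h => ?_) (fun y hy hyc h => ?_)
    (fun x hx hxk h => ?_) (fun x hx hxk h => ?_)
  · obtain ⟨j, rfl⟩ : ∃ j : ℕ, y = 2 * j + 1 := ⟨(y / 2).toNat, by grind⟩
    rcases hA j (by grind) with h1 | h1
    · rw [gridOuter_neg_one, add_sub_cancel_right]
      exact Or.inr h1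
    · exact Or.inl ⟨_, h1⟩
  · obtain ⟨j, rfl⟩ : ∃ j : ℕ, y = 2 * j := ⟨(y / 2).toNat, by grind⟩
    rcases (show (2 * j : ℤ) ≤ c - 1 by omega).eq_or_lt with h1 | h1
    · rw [h1]
      exact hC
    · rcases hA j (by grind) with h2 | h2
      · exact Or.inl ⟨_, h2⟩
      · rw [gridOuter_skip]
        exact Or.inr h2
  · obtain ⟨j, rfl⟩ : ∃ j : ℕ, x = 2 * j := ⟨(x / 2).toNat, by grind⟩
    rw [gridInner_neg_one]
    rcases hB j (by grind) with h1 | h1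
    · exact Or.inl ⟨_, h1⟩
    · exact Or.inr h1
  · obtain ⟨j, rfl⟩ : ∃ j : ℕ, x = 2 * j := ⟨(x / 2).toNat, by grind⟩
    rw [gridInner_order]
    rcases hB j (by grind) with h1 | h1
    · exact Or.inr h1
    · exact Or.inl ⟨_, h1⟩

/-- Under `hcorner`, the remaining vertex at the corner sees the class it wants in the pattern
itself. -/
lemma exists_placement_odd_even (hk : 1 ≤ k) (hc : 3 ≤ c) (hco : Odd c) (hke : Even k)
    (hσ : σ = 1 ∨ σ = -1) (hcorner : (k : ZMod 3) + σ * (c - 1) = 0) :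
    ∃ P, IsRainbowPlacement (generalizedPetersen (c * k) k) P ∧
      P.card ≤ c * k + (c - 1) / 2 + k / 2 := by
  refine ⟨gridPattern c k 0 σ ∪ columnFill c k σ ((c - 1) / 2) ∪ rowFill c k 0 σ (k / 2),
    isRainbowPlacement_odd_even hk hc hco hke hσ
      (fun _ h => Finset.mem_union_left _ (Finset.mem_union_left _ h))
      (fun j hj => Or.inl ?_) (fun j hj => Or.inl ?_) (Or.inr ?_),
    card_union_le_add (card_union_le_add card_gridPattern_le (card_columnFill_le _))
      (card_rowFill_le _)⟩
  · exact Finset.mem_union_left _ (Finset.mem_union_right _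
      (columnFill_right (by omega) (by omega) (by simp)))
  · exact Finset.mem_union_right _ (rowFill_down (Or.inl rfl) (by omega) (by omega) (by simp))
  · rw [gridOuter_skip, sub_add_cancel, gridOuter_zero_order,
      show gridClass σ k (c - 1) = gridClass σ 0 0 by
        simp only [gridClass]; push_cast; rw [hcorner]; ring]
    exact Finset.mem_union_left _ (Finset.mem_union_left _
      (outer_mem_gridPattern le_rfl (by omega) le_rfl (by omega) (by simp)))

/-- Where the two seams meet, one vertex without a class may have to be filled, and any class
serves. The single color spent there is regained by choosing, on the seams, the cheaper of two
classes. -/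
lemma three_mul_rainbowDominationNumber_le_of_choice {t b : ℕ} {S : ZMod 3 → Finset (Fin t)}
    (hS : IsColorSplit S) (hk : 1 ≤ k) (hc : 3 ≤ c) (hco : Odd c) (hke : Even k)
    (hσ : σ = 1 ∨ σ = -1) (hA : (k : ZMod 3) ≠ σ - 1)
    (hB : ∀ a, ∑ r, min (S (a + σ * c + r)).card (S (a - σ + r)).card ≤ b) :
    3 * rainbowDominationNumber t (generalizedPetersen (c * k) k) ≤
      t * (c * k) + (c - 1) / 2 * (t - 1) + k / 2 * b + 3 := by
  let fA : ℕ → (Fin (c * k) ⊕ Fin (c * k)) × ZMod 3 := fun j =>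
    (gridOuter c k (k - 1) (2 * j), gridClass σ (-1) (2 * j + 1))
  let gA : ℕ → (Fin (c * k) ⊕ Fin (c * k)) × ZMod 3 := fun j =>
    (gridOuter c k 0 (2 * j + 1), gridClass σ k (2 * j))
  let fB : ℕ → (Fin (c * k) ⊕ Fin (c * k)) × ZMod 3 := fun j =>
    (gridInner c k (2 * j) 0, gridClass σ (2 * j) c)
  let gB : ℕ → (Fin (c * k) ⊕ Fin (c * k)) × ZMod 3 := fun j =>
    (gridInner c k (2 * j) (c - 1), gridClass σ (2 * j) (-1))
  choose κ hκ using hS.exists_card_eq_one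
  let w : ZMod 3 → ZMod 3 → ℕ := fun r a => (S (a + r)).card
  let P : ZMod 3 → Finset ((Fin (c * k) ⊕ Fin (c * k)) × ZMod 3) := fun r =>
    gridPattern c k 0 σ ∪ cheaperChoice (w r) ((c - 1) / 2) fA gA ∪
      cheaperChoice (w r) (k / 2) fB gB ∪ {(gridOuter c k (k - 1) (c - 1), κ r)}
  have hP : ∀ r, IsRainbowPlacement (generalizedPetersen (c * k) k) (P r) := by
    intro r
    refine isRainbowPlacement_odd_even hk hc hco hke hσ
      (fun _ h => Finset.mem_union_left _ (Finset.mem_union_left _ (Finset.mem_union_left _ h)))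
      (fun j hj => ?_) (fun j hj => ?_)
      (Or.inl ⟨κ r, Finset.mem_union_right _ (Finset.mem_singleton_self _)⟩)
    · exact (mem_cheaperChoice (w r) hj fA gA).imp
        (fun h => Finset.mem_union_left _ (Finset.mem_union_left _ (Finset.mem_union_right _ h)))
        fun h => Finset.mem_union_left _ (Finset.mem_union_left _ (Finset.mem_union_right _ h))
    · exact (mem_cheaperChoice (w r) hj fB gB).imp
        (fun h => Finset.mem_union_left _ (Finset.mem_union_right _ h))
        fun h => Finset.mem_union_left _ (Finset.mem_union_right _ h)
  have hsum : ∀ r, ∑ p ∈ P r, (S (p.2 + r)).card ≤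
      ∑ q ∈ Finset.range k ×ˢ Finset.range c, (S (gridClass σ q.1 q.2 + r)).card +
      ∑ j ∈ Finset.range ((c - 1) / 2), min (S ((fA j).2 + r)).card (S ((gA j).2 + r)).card +
      ∑ j ∈ Finset.range (k / 2), min (S ((fB j).2 + r)).card (S ((gB j).2 + r)).card + 1 := by
    intro r
    refine sum_union_le_add (w := w r) (sum_union_le_add (sum_union_le_add ?_
      (sum_cheaperChoice_le _ fA gA)) (sum_cheaperChoice_le _ fB gB)) ?_
    · exact Finset.sum_image_le_of_nonneg fun _ _ => Nat.zero_le _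
    · rw [Finset.sum_singleton]
      exact (hκ r).le
  refine (three_mul_rainbowDominationNumber_le_sum hS hP).trans
    ((Finset.sum_le_sum fun r _ => hsum r).trans ?_)
  rw [Finset.sum_add_distrib, Finset.sum_add_distrib, Finset.sum_add_distrib]
  refine add_le_add (add_le_add (add_le_add ?_ ?_) ?_) ?_
  · rw [Finset.sum_comm, Finset.sum_congr rfl fun q _ => hS.sum_card (gridClass σ q.1 q.2)]
    simp only [Finset.sum_const, Finset.card_product, Finset.card_range, smul_eq_mul]
    exact le_of_eq (by ring)
  · refine sum_sum_min_le _ _ fA gA fun j => Nat.le_sub_one_of_lt (hS.sum_min_card _ _ ?_)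
    simp only [fA, gA, gridClass]
    push_cast
    intro h
    exact hA (by linear_combination -h)
  · refine sum_sum_min_le _ _ fB gB fun j => ?_
    have := hB (2 * j)
    simp only [fB, gB, gridClass]
    push_cast
    rwa [mul_neg_one, ← sub_eq_add_neg]
  · simp [ZMod.card]

end OddEven

/-! ### Patterns with a modified corner -/

section Corner

variable {c k : ℕ} [NeZero (c * k)]

/-- The case `c ≡ 4`, `k ≡ 3` modulo `6`. The pattern with `σ = -1` is kept, except that the
classes of the inner vertices in the cells `(0, 1)` and `(k - 1, c - 1)` are changed. A further
class at the outer vertices of the even rows, in the first and in the last column (`A₁`, `A₂`),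
repairs the column seam and at the same time the row seam at its two ends, so that the row seam
needs only `k - 2` further classes (`A₃`). -/
lemma exists_placement_even_of_one_mod_three (hk : 3 ≤ k) (hc : 4 ≤ c) (hce : Even c)
    (hko : Odd k) (hk3 : (k : ZMod 3) = 0) (hc3 : (c : ZMod 3) = 1) :
    ∃ P, IsRainbowPlacement (generalizedPetersen (c * k) k) P ∧ P.card ≤ c * k + c + (k - 2) := by
  have hc2 : c % 2 = 0 := Nat.even_iff.1 hce
  have hk2 : k % 2 = 1 := Nat.odd_iff.1 hko
  have h3 : (3 : ZMod 3) = 0 := rfl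
  have hkn : k < c * k := by nlinarith
  let C : ℤ → ℤ → ZMod 3 := fun x y =>
    if x = 0 ∧ y = 1 then 1 else if x = k - 1 ∧ y = c - 1 then 0 else gridClass (-1) x y
  let A₁ : Finset ((Fin (c * k) ⊕ Fin (c * k)) × ZMod 3) := (Finset.range (c / 2)).image
    fun j : ℕ => (gridOuter c k 0 (2 * j), if j = 0 then 2 else 1 - 2 * j)
  let A₂ : Finset ((Fin (c * k) ⊕ Fin (c * k)) × ZMod 3) := (Finset.range (c / 2)).image
    fun j : ℕ => (gridOuter c k (k - 1) (2 * j), 1 - 2 * j)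
  let A₃ : Finset ((Fin (c * k) ⊕ Fin (c * k)) × ZMod 3) := (Finset.range (k - 2)).image
    fun i : ℕ => if i % 2 = 0 then (gridInner c k (i + 1) 0, (i : ZMod 3))
      else (gridInner c k (i + 1) (c - 1), (i + 2 : ZMod 3))
  let B := cellPattern c k (fun x y => (x + y) % 2 = 0) C
  have hcard : (B ∪ A₁ ∪ A₂ ∪ A₃).card ≤ c * k + c / 2 + c / 2 + (k - 2) :=
    card_union_le_add (card_union_le_add (card_union_le_add card_cellPattern_le
      (Finset.card_image_le.trans (by simp))) (Finset.card_image_le.trans (by simp)))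
      (Finset.card_image_le.trans (by simp))
  refine ⟨B ∪ A₁ ∪ A₂ ∪ A₃, ?_, hcard.trans (by omega)⟩
  have hU : ∀ (x y : ℤ) (a : ZMod 3), 0 ≤ x → x < k → 0 ≤ y → y < c → (x + y) % 2 = 0 →
      a = x - y → (gridOuter c k x y, a) ∈ B ∪ A₁ ∪ A₂ ∪ A₃ := by
    intro x y a hx hxk hy hyc he ha
    have h := outer_mem_cellPattern (c := c) (k := k) (T := fun x y => (x + y) % 2 = 0) (C := C)
      hx hxk hy hyc he
    have h1 : C x y = a := by
      simp only [C]
      rw [if_neg (by omega), if_neg (by omega), ha, gridClass]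
      ring
    rw [h1] at h
    exact Finset.mem_union_left _ (Finset.mem_union_left _ (Finset.mem_union_left _ h))
  have hV : ∀ (x y : ℤ) (a : ZMod 3), 0 ≤ x → x < k → 0 ≤ y → y < c → (x + y) % 2 = 1 →
      a = C x y → (gridInner c k x y, a) ∈ B ∪ A₁ ∪ A₂ ∪ A₃ := by
    intro x y a hx hxk hy hyc he ha
    have h := inner_mem_cellPattern (c := c) (k := k) (T := fun x y => (x + y) % 2 = 0) (C := C)
      hx hxk hy hyc (by omega)
    rw [ha]
    exact Finset.mem_union_left _ (Finset.mem_union_left _ (Finset.mem_union_left _ h))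
  have hV' : ∀ (x y : ℤ) (a : ZMod 3), 0 ≤ x → x < k → 0 ≤ y → y < c → (x + y) % 2 = 1 →
      ¬ (x = 0 ∧ y = 1) → ¬ (x = k - 1 ∧ y = c - 1) → a = x - y →
      (gridInner c k x y, a) ∈ B ∪ A₁ ∪ A₂ ∪ A₃ := by
    intro x y a hx hxk hy hyc he h1 h2 ha
    refine hV x y a hx hxk hy hyc he ?_
    simp only [C]
    rw [if_neg h1, if_neg h2, ha, gridClass]
    ring
  have hU0 : ∀ (y : ℤ) (a : ZMod 3), 0 < y → y < c → y % 2 = 0 → a = 1 - y →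
      (gridOuter c k 0 y, a) ∈ B ∪ A₁ ∪ A₂ ∪ A₃ := by
    intro y a hy hyc he ha
    obtain ⟨j, rfl⟩ : ∃ j : ℕ, y = 2 * j := ⟨(y / 2).toNat, by omega⟩
    refine Finset.mem_union_left _ (Finset.mem_union_left _ (Finset.mem_union_right _
      (Finset.mem_image.2 ⟨j, Finset.mem_range.2 (by omega), ?_⟩)))
    rw [if_neg (by omega), ha]
    push_cast
    rfl
  have hU00 : (gridOuter c k 0 0, (2 : ZMod 3)) ∈ B ∪ A₁ ∪ A₂ ∪ A₃ :=
    Finset.mem_union_left _ (Finset.mem_union_left _ (Finset.mem_union_right _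
      (Finset.mem_image.2 ⟨0, Finset.mem_range.2 (by omega), by simp⟩)))
  have hUk : ∀ (y : ℤ) (a : ZMod 3), 0 ≤ y → y < c → y % 2 = 0 → a = 1 - y →
      (gridOuter c k (k - 1) y, a) ∈ B ∪ A₁ ∪ A₂ ∪ A₃ := by
    intro y a hy hyc he ha
    obtain ⟨j, rfl⟩ : ∃ j : ℕ, y = 2 * j := ⟨(y / 2).toNat, by omega⟩
    refine Finset.mem_union_left _ (Finset.mem_union_right _
      (Finset.mem_image.2 ⟨j, Finset.mem_range.2 (by omega), ?_⟩))
    rw [ha]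
    push_cast
    rfl
  have hVup : ∀ (x : ℤ) (a : ZMod 3), 0 < x → x < k - 1 → x % 2 = 1 → a = x - 1 →
      (gridInner c k x 0, a) ∈ B ∪ A₁ ∪ A₂ ∪ A₃ := by
    intro x a hx hxk he ha
    obtain ⟨i, rfl⟩ : ∃ i : ℕ, x = i + 1 := ⟨(x - 1).toNat, by omega⟩
    refine Finset.mem_union_right _ (Finset.mem_image.2 ⟨i, Finset.mem_range.2 (by omega), ?_⟩)
    rw [if_pos (by omega), ha]
    push_cast
    rw [add_sub_cancel_right]
  have hVdown : ∀ (x : ℤ) (a : ZMod 3), 0 < x → x < k - 1 → x % 2 = 0 → a = x + 1 →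
      (gridInner c k x (c - 1), a) ∈ B ∪ A₁ ∪ A₂ ∪ A₃ := by
    intro x a hx hxk he ha
    obtain ⟨i, rfl⟩ : ∃ i : ℕ, x = i + 1 := ⟨(x - 1).toNat, by omega⟩
    refine Finset.mem_union_right _ (Finset.mem_image.2 ⟨i, Finset.mem_range.2 (by omega), ?_⟩)
    rw [if_neg (by omega), ha]
    push_cast
    rw [add_assoc, one_add_one_eq_two]
  generalize B ∪ A₁ ∪ A₂ ∪ A₃ = P at *
  refine isRainbowPlacement_of_cells fun x y hx hxk hy hyc => ⟨?_, ?_⟩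
  · rcases (by omega : (x + y) % 2 = 0 ∨ (x + y) % 2 = 1) with hp | hp
    · exact Or.inl ⟨_, hU x y _ hx hxk hy hyc hp rfl⟩
    refine Or.inr ?_
    rcases hx.eq_or_lt with rfl | hx0
    · refine seesAll_gridOuter (by omega) (-y : ZMod 3) fun a ha => ?_
      rw [zero_sub, gridOuter_neg_one]
      rcases ha with ha | ha | ha
      · exact Or.inl (hUk _ _ (by omega) (by omega) (by omega)
          (by push_cast; linear_combination ha - h3))
      · exact Or.inl (hU _ _ _ (by omega) (by omega) (by omega) (by omega) (by omega)
          (by push_cast; linear_combination ha - hk3))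
      · exact Or.inr (Or.inl (hU _ _ _ (by omega) (by omega) hy hyc (by omega)
          (by push_cast; linear_combination ha)))
    rcases (show x ≤ k - 1 by omega).eq_or_lt with rfl | hxk0
    · rw [← sub_add_cancel (k : ℤ) 1] at hxk
      refine seesAll_gridOuter (by omega) (-y : ZMod 3) fun a ha => ?_
      rw [sub_add_cancel, gridOuter_skip]
      rcases (show y ≤ c - 1 by omega).eq_or_lt with rfl | hyc0
      · rw [sub_add_cancel, gridOuter_zero_order]
        push_cast at ha
        rcases ha with ha | ha | ha
        · refine Or.inr (Or.inl ?_)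
          convert hU00 using 2
          linear_combination ha - hc3 - h3
        · exact Or.inr (Or.inl (hU _ _ _ le_rfl (by omega) le_rfl (by omega) (by simp)
            (by push_cast; linear_combination ha - hc3)))
        · exact Or.inl (hU _ _ _ (by omega) (by omega) (by omega) (by omega) (by omega)
            (by push_cast; linear_combination ha - hk3 + h3))
      · rcases ha with ha | ha | ha
        · exact Or.inr (Or.inl (hU _ _ _ le_rfl (by omega) (by omega) (by omega) (by omega)
            (by push_cast; linear_combination ha)))
        · exact Or.inr (Or.inl (hU0 _ _ (by omega) (by omega) (by omega)
            (by push_cast; linear_combination ha)))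
        · exact Or.inl (hU _ _ _ (by omega) (by omega) (by omega) (by omega) (by omega)
            (by push_cast; linear_combination ha - hk3 + h3))
    · refine seesAll_gridOuter (by omega) (x - y : ZMod 3) fun a ha => ?_
      rcases ha with ha | ha | ha
      · exact Or.inl (hU _ _ _ (by omega) (by omega) hy hyc (by omega)
          (by push_cast; linear_combination ha))
      · exact Or.inr (Or.inr (hV' _ _ _ hx hxk hy hyc hp (by omega) (by omega) ha))
      · exact Or.inr (Or.inl (hU _ _ _ (by omega) (by omega) hy hyc (by omega)
          (by push_cast; linear_combination ha)))
  · rcases (by omega : (x + y) % 2 = 1 ∨ (x + y) % 2 = 0) with hp | hp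
    · exact Or.inl ⟨_, hV x y _ hx hxk hy hyc hp rfl⟩
    refine Or.inr ?_
    rcases hx.eq_or_lt with rfl | hx0
    · rcases hy.eq_or_lt with rfl | hy0
      · refine seesAll_gridInner (by omega) hkn 0 fun a ha => ?_
        rcases ha with ha | ha | ha
        · rw [ha]
          exact Or.inr (Or.inr hU00)
        · exact Or.inr (Or.inr (hU _ _ _ le_rfl hxk le_rfl hyc hp (by simpa using ha)))
        · refine Or.inr (Or.inl (hV _ _ _ le_rfl hxk (by omega) (by omega) (by simp) ?_))
          simpa [C] using ha
      · refine seesAll_gridInner (by omega) hkn (-y : ZMod 3) fun a ha => ?_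
        rcases ha with ha | ha | ha
        · exact Or.inr (Or.inl (hV' _ _ _ le_rfl hxk (by omega) (by omega) (by omega) (by omega)
            (by omega) (by push_cast; linear_combination ha)))
        · exact Or.inr (Or.inr (hU _ _ _ le_rfl hxk hy hyc hp
            (by push_cast; linear_combination ha)))
        · exact Or.inr (Or.inr (hU0 _ _ hy0 hyc (by omega) (by linear_combination ha)))
    rcases (show x ≤ k - 1 by omega).eq_or_lt with rfl | hxk0
    · refine seesAll_gridInner (by omega) hkn (-y : ZMod 3) fun a ha => ?_
      rcases ha with ha | ha | ha
      · exact Or.inr (Or.inr (hU _ _ _ hx hxk hy hyc hp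
          (by push_cast; linear_combination ha - hk3)))
      · refine Or.inl ?_
        rcases hy.eq_or_lt with rfl | hy0
        · rw [zero_sub, gridInner_neg_one]
          refine hV _ _ _ hx hxk (by omega) (by omega) (by omega) ?_
          simp only [C]
          rw [if_neg (by omega), if_pos (by simp)]
          simpa using ha
        · exact hV' _ _ _ hx hxk (by omega) (by omega) (by omega) (by omega) (by omega)
            (by push_cast; linear_combination ha - hk3)
      · exact Or.inr (Or.inr (hUk _ _ hy hyc (by omega) (by linear_combination ha)))
    · refine seesAll_gridInner (by omega) hkn (x - y : ZMod 3) fun a ha => ?_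
      rcases ha with ha | ha | ha
      · refine Or.inr (Or.inl ?_)
        rcases (show y ≤ c - 1 by omega).eq_or_lt with rfl | hyc0
        · rw [sub_add_cancel, gridInner_order]
          exact hVup _ _ hx0 hxk0 (by omega) (by push_cast at ha; linear_combination ha - hc3)
        · exact hV' _ _ _ hx hxk (by omega) (by omega) (by omega) (by omega) (by omega)
            (by push_cast; linear_combination ha)
      · exact Or.inr (Or.inr (hU _ _ _ hx hxk hy hyc hp ha))
      · refine Or.inl ?_
        rcases hy.eq_or_lt with rfl | hy0
        · rw [zero_sub, gridInner_neg_one]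
          exact hVdown _ _ hx0 hxk0 (by omega) (by simpa using ha)
        · exact hV' _ _ _ hx hxk (by omega) (by omega) (by omega) (by omega) (by omega)
            (by push_cast; linear_combination ha)

/-- The case `c ≡ 2`, `k ≡ 3` modulo `6`, with `σ = 1` and changed classes in the cells `(0, 0)` and
`(0, 1)`. The further classes are as in `exists_placement_even_of_one_mod_three`. -/
lemma exists_placement_even_of_two_mod_three (hk : 3 ≤ k) (hc : 4 ≤ c) (hce : Even c)
    (hko : Odd k) (hk3 : (k : ZMod 3) = 0) (hc3 : (c : ZMod 3) = 2) :
    ∃ P, IsRainbowPlacement (generalizedPetersen (c * k) k) P ∧ P.card ≤ c * k + c + (k - 2) := by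
  have hc2 : c % 2 = 0 := Nat.even_iff.1 hce
  have hk2 : k % 2 = 1 := Nat.odd_iff.1 hko
  have h3 : (3 : ZMod 3) = 0 := rfl
  have hkn : k < c * k := by nlinarith
  let C : ℤ → ℤ → ZMod 3 := fun x y =>
    if x = 0 ∧ y = 0 then 1 else if x = 0 ∧ y = 1 then 0 else gridClass 1 x y
  let A₁ : Finset ((Fin (c * k) ⊕ Fin (c * k)) × ZMod 3) := (Finset.range (c / 2)).image
    fun j : ℕ => (gridOuter c k 0 (2 * j), 2 * j - 1)
  let A₂ : Finset ((Fin (c * k) ⊕ Fin (c * k)) × ZMod 3) := (Finset.range (c / 2)).image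
    fun j : ℕ => (gridOuter c k (k - 1) (2 * j), if j = 0 then 1 else 2 * j)
  let A₃ : Finset ((Fin (c * k) ⊕ Fin (c * k)) × ZMod 3) := (Finset.range (k - 2)).image
    fun i : ℕ => (if i % 2 = 0 then gridInner c k (i + 1) 0 else gridInner c k (i + 1) (c - 1),
      (i : ZMod 3))
  let B := cellPattern c k (fun x y => (x + y) % 2 = 0) C
  have hcard : (B ∪ A₁ ∪ A₂ ∪ A₃).card ≤ c * k + c / 2 + c / 2 + (k - 2) :=
    card_union_le_add (card_union_le_add (card_union_le_add card_cellPattern_le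
      (Finset.card_image_le.trans (by simp))) (Finset.card_image_le.trans (by simp)))
      (Finset.card_image_le.trans (by simp))
  refine ⟨B ∪ A₁ ∪ A₂ ∪ A₃, ?_, hcard.trans (by omega)⟩
  have hU : ∀ (x y : ℤ) (a : ZMod 3), 0 ≤ x → x < k → 0 ≤ y → y < c → (x + y) % 2 = 0 →
      a = C x y → (gridOuter c k x y, a) ∈ B ∪ A₁ ∪ A₂ ∪ A₃ := by
    intro x y a hx hxk hy hyc he ha
    have h := outer_mem_cellPattern (c := c) (k := k) (T := fun x y => (x + y) % 2 = 0) (C := C)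
      hx hxk hy hyc he
    rw [ha]
    exact Finset.mem_union_left _ (Finset.mem_union_left _ (Finset.mem_union_left _ h))
  have hV : ∀ (x y : ℤ) (a : ZMod 3), 0 ≤ x → x < k → 0 ≤ y → y < c → (x + y) % 2 = 1 →
      a = C x y → (gridInner c k x y, a) ∈ B ∪ A₁ ∪ A₂ ∪ A₃ := by
    intro x y a hx hxk hy hyc he ha
    have h := inner_mem_cellPattern (c := c) (k := k) (T := fun x y => (x + y) % 2 = 0) (C := C)
      hx hxk hy hyc (by omega)
    rw [ha]
    exact Finset.mem_union_left _ (Finset.mem_union_left _ (Finset.mem_union_left _ h))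
  have hC : ∀ (x y : ℤ) (a : ZMod 3), ¬ (x = 0 ∧ y = 0) → ¬ (x = 0 ∧ y = 1) → a = x + y →
      a = C x y := by
    intro x y a h1 h2 ha
    simp only [C]
    rw [if_neg h1, if_neg h2, ha, gridClass]
    ring
  have hU' : ∀ (x y : ℤ) (a : ZMod 3), 0 ≤ x → x < k → 0 ≤ y → y < c → (x + y) % 2 = 0 →
      ¬ (x = 0 ∧ y = 0) → a = x + y → (gridOuter c k x y, a) ∈ B ∪ A₁ ∪ A₂ ∪ A₃ :=
    fun x y a hx hxk hy hyc he h1 ha => hU x y a hx hxk hy hyc he (hC x y a h1 (by omega) ha)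
  have hV' : ∀ (x y : ℤ) (a : ZMod 3), 0 ≤ x → x < k → 0 ≤ y → y < c → (x + y) % 2 = 1 →
      ¬ (x = 0 ∧ y = 1) → a = x + y → (gridInner c k x y, a) ∈ B ∪ A₁ ∪ A₂ ∪ A₃ :=
    fun x y a hx hxk hy hyc he h1 ha => hV x y a hx hxk hy hyc he (hC x y a (by omega) h1 ha)
  have hU0 : ∀ (y : ℤ) (a : ZMod 3), 0 ≤ y → y < c → y % 2 = 0 → a = y - 1 →
      (gridOuter c k 0 y, a) ∈ B ∪ A₁ ∪ A₂ ∪ A₃ := by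
    intro y a hy hyc he ha
    obtain ⟨j, rfl⟩ : ∃ j : ℕ, y = 2 * j := ⟨(y / 2).toNat, by omega⟩
    refine Finset.mem_union_left _ (Finset.mem_union_left _ (Finset.mem_union_right _
      (Finset.mem_image.2 ⟨j, Finset.mem_range.2 (by omega), ?_⟩)))
    rw [ha]
    push_cast
    rfl
  have hUk : ∀ (y : ℤ) (a : ZMod 3), 0 < y → y < c → y % 2 = 0 → a = y →
      (gridOuter c k (k - 1) y, a) ∈ B ∪ A₁ ∪ A₂ ∪ A₃ := by
    intro y a hy hyc he ha
    obtain ⟨j, rfl⟩ : ∃ j : ℕ, y = 2 * j := ⟨(y / 2).toNat, by omega⟩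
    refine Finset.mem_union_left _ (Finset.mem_union_right _
      (Finset.mem_image.2 ⟨j, Finset.mem_range.2 (by omega), ?_⟩))
    rw [if_neg (by omega), ha]
    push_cast
    rfl
  have hUk0 : (gridOuter c k (k - 1) 0, (1 : ZMod 3)) ∈ B ∪ A₁ ∪ A₂ ∪ A₃ :=
    Finset.mem_union_left _ (Finset.mem_union_right _
      (Finset.mem_image.2 ⟨0, Finset.mem_range.2 (by omega), by simp⟩))
  have hVup : ∀ (x : ℤ) (a : ZMod 3), 0 < x → x < k - 1 → x % 2 = 1 → a = x - 1 →
      (gridInner c k x 0, a) ∈ B ∪ A₁ ∪ A₂ ∪ A₃ := by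
    intro x a hx hxk he ha
    obtain ⟨i, rfl⟩ : ∃ i : ℕ, x = i + 1 := ⟨(x - 1).toNat, by omega⟩
    refine Finset.mem_union_right _ (Finset.mem_image.2 ⟨i, Finset.mem_range.2 (by omega), ?_⟩)
    rw [if_pos (by omega), ha]
    push_cast
    rw [add_sub_cancel_right]
  have hVdown : ∀ (x : ℤ) (a : ZMod 3), 0 < x → x < k - 1 → x % 2 = 0 → a = x - 1 →
      (gridInner c k x (c - 1), a) ∈ B ∪ A₁ ∪ A₂ ∪ A₃ := by
    intro x a hx hxk he ha
    obtain ⟨i, rfl⟩ : ∃ i : ℕ, x = i + 1 := ⟨(x - 1).toNat, by omega⟩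
    refine Finset.mem_union_right _ (Finset.mem_image.2 ⟨i, Finset.mem_range.2 (by omega), ?_⟩)
    rw [if_neg (by omega), ha]
    push_cast
    rw [add_sub_cancel_right]
  have hU00 : (gridOuter c k 0 0, (1 : ZMod 3)) ∈ B ∪ A₁ ∪ A₂ ∪ A₃ :=
    hU 0 0 1 le_rfl (by omega) le_rfl (by omega) (by omega) (by simp [C])
  have hU00' : (gridOuter c k 0 0, (2 : ZMod 3)) ∈ B ∪ A₁ ∪ A₂ ∪ A₃ :=
    hU0 0 2 le_rfl (by omega) (by omega) rfl
  have hV01 : (gridInner c k 0 1, (0 : ZMod 3)) ∈ B ∪ A₁ ∪ A₂ ∪ A₃ :=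
    hV 0 1 0 le_rfl (by omega) (by omega) (by omega) (by omega) (by simp [C])
  have hUk0' : (gridOuter c k (k - 1) 0, (2 : ZMod 3)) ∈ B ∪ A₁ ∪ A₂ ∪ A₃ :=
    hU' _ _ _ (by omega) (by omega) le_rfl (by omega) (by omega) (by omega)
      (by push_cast; linear_combination h3 - hk3)
  generalize B ∪ A₁ ∪ A₂ ∪ A₃ = P at *
  refine isRainbowPlacement_of_cells fun x y hx hxk hy hyc => ⟨?_, ?_⟩
  · rcases (by omega : (x + y) % 2 = 0 ∨ (x + y) % 2 = 1) with hp | hp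
    · exact Or.inl ⟨_, hU x y _ hx hxk hy hyc hp rfl⟩
    refine Or.inr ?_
    rcases hx.eq_or_lt with rfl | hx0
    · by_cases hy1 : y = 1
      · subst hy1
        refine seesAll_gridOuter (by omega) 1 fun a ha => ?_
        rw [zero_sub, gridOuter_neg_one, sub_self]
        rcases ha with rfl | rfl | rfl
        · exact Or.inr (Or.inr hV01)
        · exact Or.inl hUk0
        · exact Or.inl hUk0'
      · refine seesAll_gridOuter (by omega) (y : ZMod 3) fun a ha => ?_
        rw [zero_sub, gridOuter_neg_one]
        rcases ha with ha | ha | ha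
        · exact Or.inl (hUk _ _ (by omega) (by omega) (by omega)
            (by push_cast; linear_combination ha))
        · exact Or.inr (Or.inr (hV' _ _ _ le_rfl hxk hy hyc hp (by omega)
            (by push_cast; linear_combination ha)))
        · exact Or.inr (Or.inl (hU' _ _ _ (by omega) (by omega) hy hyc (by omega) (by omega)
            (by push_cast; linear_combination ha)))
    rcases (show x ≤ k - 1 by omega).eq_or_lt with rfl | hxk0
    · have hown : ∀ a : ZMod 3, a = y - 1 → (gridInner c k (k - 1) y, a) ∈ P := fun a ha =>
        hV' _ _ _ hx hxk hy hyc hp (by omega) (by push_cast; linear_combination ha - hk3)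
      rcases (show y ≤ c - 1 by omega).eq_or_lt with rfl | hyc0
      · refine seesAll_gridOuter (by omega) 1 fun a ha => ?_
        rw [sub_add_cancel, gridOuter_skip, sub_add_cancel, gridOuter_zero_order]
        rcases ha with rfl | rfl | rfl
        · exact Or.inr (Or.inr (hown _ (by push_cast; linear_combination -hc3)))
        · exact Or.inr (Or.inl hU00)
        · exact Or.inr (Or.inl hU00')
      · refine seesAll_gridOuter (by omega) (y : ZMod 3) fun a ha => ?_
        rw [sub_add_cancel, gridOuter_skip]
        rcases ha with ha | ha | ha
        · exact Or.inr (Or.inr (hown _ ha))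
        · exact Or.inr (Or.inl (hU0 _ _ (by omega) (by omega) (by omega)
            (by push_cast; linear_combination ha)))
        · exact Or.inr (Or.inl (hU' _ _ _ le_rfl (by omega) (by omega) (by omega) (by omega)
            (by omega) (by push_cast; linear_combination ha)))
    · by_cases hxy : x = 1 ∧ y = 0
      · obtain ⟨rfl, rfl⟩ := hxy
        refine seesAll_gridOuter (by omega) 1 fun a ha => ?_
        rw [sub_self]
        rcases ha with rfl | rfl | rfl
        · exact Or.inr (Or.inr (hVup _ _ hx0 hxk0 (by omega) (by push_cast; ring)))
        · exact Or.inl hU00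
        · exact Or.inl hU00'
      · refine seesAll_gridOuter (by omega) (x + y : ZMod 3) fun a ha => ?_
        rcases ha with ha | ha | ha
        · exact Or.inl (hU' _ _ _ (by omega) (by omega) hy hyc (by omega) (by omega)
            (by push_cast; linear_combination ha))
        · exact Or.inr (Or.inr (hV' _ _ _ hx hxk hy hyc hp (by omega) ha))
        · exact Or.inr (Or.inl (hU' _ _ _ (by omega) (by omega) hy hyc (by omega) (by omega)
            (by push_cast; linear_combination ha)))
  · rcases (by omega : (x + y) % 2 = 1 ∨ (x + y) % 2 = 0) with hp | hp
    · exact Or.inl ⟨_, hV x y _ hx hxk hy hyc hp rfl⟩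
    refine Or.inr ?_
    rcases hx.eq_or_lt with rfl | hx0
    · rcases hy.eq_or_lt with rfl | hy0
      · refine seesAll_gridInner (by omega) hkn 1 fun a ha => ?_
        rw [zero_add]
        rcases ha with rfl | rfl | rfl
        · exact Or.inr (Or.inl hV01)
        · exact Or.inr (Or.inr hU00)
        · exact Or.inr (Or.inr hU00')
      · refine seesAll_gridInner (by omega) hkn (y : ZMod 3) fun a ha => ?_
        rcases ha with ha | ha | ha
        · exact Or.inr (Or.inr (hU0 _ _ hy hyc (by omega) ha))
        · exact Or.inr (Or.inr (hU' _ _ _ le_rfl hxk hy hyc hp (by omega)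
            (by push_cast; linear_combination ha)))
        · exact Or.inr (Or.inl (hV' _ _ _ le_rfl hxk (by omega) (by omega) (by omega) (by omega)
            (by push_cast; linear_combination ha)))
    rcases (show x ≤ k - 1 by omega).eq_or_lt with rfl | hxk0
    · rcases hy.eq_or_lt with rfl | hy0
      · refine seesAll_gridInner (by omega) hkn 1 fun a ha => ?_
        rw [zero_add]
        rcases ha with rfl | rfl | rfl
        · exact Or.inr (Or.inl (hV' _ _ _ hx hxk (by omega) (by omega) (by omega) (by omega)
            (by push_cast; linear_combination -hk3)))
        · exact Or.inr (Or.inr hUk0)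
        · exact Or.inr (Or.inr hUk0')
      · refine seesAll_gridInner (by omega) hkn (y : ZMod 3) fun a ha => ?_
        rcases ha with ha | ha | ha
        · exact Or.inr (Or.inr (hU' _ _ _ hx hxk hy hyc hp (by omega)
            (by push_cast; linear_combination ha - hk3)))
        · exact Or.inr (Or.inr (hUk _ _ hy0 hyc (by omega) ha))
        · exact Or.inl (hV' _ _ _ hx hxk (by omega) (by omega) (by omega) (by omega)
            (by push_cast; linear_combination ha - hk3 + h3))
    · refine seesAll_gridInner (by omega) hkn (x + y : ZMod 3) fun a ha => ?_
      rcases ha with ha | ha | ha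
      · refine Or.inl ?_
        rcases hy.eq_or_lt with rfl | hy0
        · rw [zero_sub, gridInner_neg_one]
          exact hVdown _ _ hx0 hxk0 (by omega) (by simpa using ha)
        · exact hV' _ _ _ hx hxk (by omega) (by omega) (by omega) (by omega)
            (by push_cast; linear_combination ha)
      · exact Or.inr (Or.inr (hU' _ _ _ hx hxk hy hyc hp (by omega) ha))
      · refine Or.inr (Or.inl ?_)
        rcases (show y ≤ c - 1 by omega).eq_or_lt with rfl | hyc0
        · rw [sub_add_cancel, gridInner_order]
          exact hVup _ _ hx0 hxk0 (by omega)
            (by push_cast at ha; linear_combination ha + hc3 + h3)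
        · exact hV' _ _ _ hx hxk (by omega) (by omega) (by omega) (by omega)
            (by push_cast; linear_combination ha)

/-- The case `c = 5`, `6 ∣ k`, with `σ = 1` and the parity offset `1`. In the first column the
classes of the cells `(0, 0)` and `(0, 2)` are changed and the class of `(0, 4)` is changed and
moved to the outer vertex. This repairs the column seam with only two further classes (`A₁`); the
row seam is repaired as in `rowFill` (`A₂`). -/
lemma exists_placement_five [NeZero (5 * k)] (hk : 6 ≤ k) (hke : Even k)
    (hk3 : (k : ZMod 3) = 0) :
    ∃ P, IsRainbowPlacement (generalizedPetersen (5 * k) k) P ∧ P.card ≤ 5 * k + 2 + k / 2 := by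
  have hk2 : k % 2 = 0 := Nat.even_iff.1 hke
  have h3 : (3 : ZMod 3) = 0 := rfl
  have hkn : k < 5 * k := by omega
  let T : ℤ → ℤ → Prop := fun x y => (x + y) % 2 = 1 ∨ (x = 0 ∧ y = 4)
  let C : ℤ → ℤ → ZMod 3 := fun x y =>
    if x = 0 ∧ y = 0 then 2 else if x = 0 ∧ y = 2 then 0 else if x = 0 ∧ y = 4 then 0
    else gridClass 1 x y
  let A₁ : Finset ((Fin (5 * k) ⊕ Fin (5 * k)) × ZMod 3) :=
    {(gridOuter 5 k 0 2, 1), (gridInner 5 k 0 3, 1)}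
  let A₂ : Finset ((Fin (5 * k) ⊕ Fin (5 * k)) × ZMod 3) := (Finset.range (k / 2)).image
    fun j : ℕ => (gridInner 5 k (2 * j + 1) 0, 2 * j)
  let B := cellPattern 5 k T C
  refine ⟨B ∪ A₁ ∪ A₂, ?_, card_union_le_add (card_union_le_add card_cellPattern_le
    Finset.card_le_two) (Finset.card_image_le.trans (by simp))⟩
  have hU : ∀ (x y : ℤ) (a : ZMod 3), 0 ≤ x → x < k → 0 ≤ y → y < 5 → T x y →
      a = C x y → (gridOuter 5 k x y, a) ∈ B ∪ A₁ ∪ A₂ := by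
    intro x y a hx hxk hy hyc he ha
    have h := outer_mem_cellPattern (c := 5) (k := k) (T := T) (C := C) hx hxk hy hyc he
    rw [ha]
    exact Finset.mem_union_left _ (Finset.mem_union_left _ h)
  have hV : ∀ (x y : ℤ) (a : ZMod 3), 0 ≤ x → x < k → 0 ≤ y → y < 5 → ¬ T x y →
      a = C x y → (gridInner 5 k x y, a) ∈ B ∪ A₁ ∪ A₂ := by
    intro x y a hx hxk hy hyc he ha
    have h := inner_mem_cellPattern (c := 5) (k := k) (T := T) (C := C) hx hxk hy hyc he
    rw [ha]
    exact Finset.mem_union_left _ (Finset.mem_union_left _ h)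
  have hC : ∀ (x y : ℤ) (a : ZMod 3), ¬ (x = 0 ∧ y % 2 = 0) → a = x + y → a = C x y := by
    intro x y a h1 ha
    simp only [C]
    rw [if_neg (by omega), if_neg (by omega), if_neg (by omega), ha, gridClass]
    ring
  have hU' : ∀ (x y : ℤ) (a : ZMod 3), 0 ≤ x → x < k → 0 ≤ y → y < 5 → (x + y) % 2 = 1 →
      a = x + y → (gridOuter 5 k x y, a) ∈ B ∪ A₁ ∪ A₂ :=
    fun x y a hx hxk hy hyc he ha => hU x y a hx hxk hy hyc (Or.inl he) (hC x y a (by omega) ha)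
  have hV' : ∀ (x y : ℤ) (a : ZMod 3), 0 < x → x < k → 0 ≤ y → y < 5 → (x + y) % 2 = 0 →
      a = x + y → (gridInner 5 k x y, a) ∈ B ∪ A₁ ∪ A₂ :=
    fun x y a hx hxk hy hyc he ha =>
      hV x y a hx.le hxk hy hyc (by simp only [T]; omega) (hC x y a (by omega) ha)
  have hV00 : (gridInner 5 k 0 0, (2 : ZMod 3)) ∈ B ∪ A₁ ∪ A₂ :=
    hV 0 0 2 le_rfl (by omega) le_rfl (by omega) (by simp [T]) (by simp [C])
  have hV02 : (gridInner 5 k 0 2, (0 : ZMod 3)) ∈ B ∪ A₁ ∪ A₂ :=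
    hV 0 2 0 le_rfl (by omega) (by omega) (by omega) (by simp [T]) (by simp [C])
  have hU04 : (gridOuter 5 k 0 4, (0 : ZMod 3)) ∈ B ∪ A₁ ∪ A₂ :=
    hU 0 4 0 le_rfl (by omega) (by omega) (by omega) (by simp [T]) (by simp [C])
  have hU02 : (gridOuter 5 k 0 2, (1 : ZMod 3)) ∈ B ∪ A₁ ∪ A₂ :=
    Finset.mem_union_left _ (Finset.mem_union_right _ (by simp [A₁]))
  have hV03 : (gridInner 5 k 0 3, (1 : ZMod 3)) ∈ B ∪ A₁ ∪ A₂ :=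
    Finset.mem_union_left _ (Finset.mem_union_right _ (by simp [A₁]))
  have hVup : ∀ (x : ℤ) (a : ZMod 3), 0 < x → x < k → x % 2 = 1 → a = x - 1 →
      (gridInner 5 k x 0, a) ∈ B ∪ A₁ ∪ A₂ := by
    intro x a hx hxk he ha
    obtain ⟨j, rfl⟩ : ∃ j : ℕ, x = 2 * j + 1 := ⟨(x / 2).toNat, by omega⟩
    refine Finset.mem_union_right _ (Finset.mem_image.2 ⟨j, Finset.mem_range.2 (by omega), ?_⟩)
    rw [ha]
    push_cast
    rw [add_sub_cancel_right]
  generalize B ∪ A₁ ∪ A₂ = P at *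
  have hwrap : gridOuter 5 k (-1) 0 = gridOuter 5 k (k - 1) 4 := by
    rw [gridOuter_neg_one_zero]
    norm_num
  have hwrap' : ∀ x, gridInner 5 k x 5 = gridInner 5 k x 0 := fun x => by
    simpa using gridInner_order (c := 5) (k := k) x
  refine isRainbowPlacement_of_cells fun x y hx hxk hy hyc => ?_
  replace hyc : y < 5 := by exact_mod_cast hyc
  refine ⟨?_, ?_⟩
  · rcases (by omega : (x + y) % 2 = 1 ∨ (x + y) % 2 = 0) with hp | hp
    · exact Or.inl ⟨_, hU' x y _ hx hxk hy hyc hp rfl⟩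
    rcases hx.eq_or_lt with rfl | hx0
    · obtain rfl | rfl | rfl : y = 0 ∨ y = 2 ∨ y = 4 := by omega
      · refine Or.inr (seesAll_gridOuter (by omega) 0 fun a ha => ?_)
        rw [zero_sub, hwrap]
        rcases ha with rfl | rfl | rfl
        · exact Or.inr (Or.inr hV00)
        · exact Or.inl (hU' _ _ _ (by omega) (by omega) (by omega) (by omega) (by omega)
            (by push_cast; linear_combination -hk3 - h3))
        · exact Or.inr (Or.inl (hU' _ _ _ (by omega) (by omega) le_rfl hyc (by omega)
            (by push_cast; ring)))
      · exact Or.inl ⟨_, hU02⟩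
      · exact Or.inl ⟨_, hU04⟩
    refine Or.inr (seesAll_gridOuter (by omega) (x + y : ZMod 3) fun a ha => ?_)
    rcases ha with ha | ha | ha
    · exact Or.inl (hU' _ _ _ (by omega) (by omega) hy hyc (by omega)
        (by push_cast; linear_combination ha))
    · exact Or.inr (Or.inr (hV' _ _ _ hx0 hxk hy hyc hp ha))
    · refine Or.inr (Or.inl ?_)
      rcases (show x ≤ k - 1 by omega).eq_or_lt with rfl | hxk0
      · rw [sub_add_cancel, gridOuter_skip]
        obtain rfl | rfl : y = 1 ∨ y = 3 := by omega
        · rw [show a = 1 by push_cast at ha; linear_combination ha + hk3]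
          exact hU02
        · rw [show a = 0 by push_cast at ha; linear_combination ha + hk3 + h3]
          exact hU04
      · exact hU' _ _ _ (by omega) (by omega) hy hyc (by omega)
          (by push_cast; linear_combination ha)
  · rcases hx.eq_or_lt with rfl | hx0
    · obtain rfl | rfl | rfl | rfl | rfl : y = 0 ∨ y = 1 ∨ y = 2 ∨ y = 3 ∨ y = 4 := by omega
      · exact Or.inl ⟨_, hV00⟩
      · refine Or.inr (seesAll_gridInner (by omega) hkn 0 fun a ha => ?_)
        rcases ha with rfl | rfl | rfl
        · exact Or.inl hV00
        · exact Or.inr (Or.inl hV02)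
        · exact Or.inr (Or.inr (hU' _ _ _ le_rfl hxk hy hyc (by omega) (by push_cast; ring)))
      · exact Or.inl ⟨_, hV02⟩
      · exact Or.inl ⟨_, hV03⟩
      · refine Or.inr (seesAll_gridInner (by omega) hkn 0 fun a ha => ?_)
        rcases ha with rfl | rfl | rfl
        · refine Or.inr (Or.inl ?_)
          have := hwrap' 0
          rw [show (4 : ℤ) + 1 = 5 by norm_num, this]
          exact hV00
        · exact Or.inr (Or.inr hU04)
        · exact Or.inl hV03
    · rcases (by omega : (x + y) % 2 = 0 ∨ (x + y) % 2 = 1) with hp | hp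
      · exact Or.inl ⟨_, hV' x y _ hx0 hxk hy hyc hp rfl⟩
      rcases hy.eq_or_lt with rfl | hy0
      · exact Or.inl ⟨_, hVup _ _ hx0 hxk (by omega) rfl⟩
      refine Or.inr (seesAll_gridInner (by omega) hkn (x + y : ZMod 3) fun a ha => ?_)
      rcases ha with ha | ha | ha
      · exact Or.inl (hV' _ _ _ hx0 hxk (by omega) (by omega) (by omega)
          (by push_cast; linear_combination ha))
      · exact Or.inr (Or.inr (hU' _ _ _ hx hxk hy hyc hp ha))
      · refine Or.inr (Or.inl ?_)
        rcases (show y ≤ 4 by omega).eq_or_lt with rfl | hy4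
        · rw [show (4 : ℤ) + 1 = 5 by norm_num, hwrap']
          exact hVup _ _ hx0 hxk (by omega) (by push_cast at ha; linear_combination ha + 2 * h3)
        · exact hV' _ _ _ hx0 hxk (by omega) (by omega) (by omega)
            (by push_cast; linear_combination ha)

end Corner

/-! ### The bounds in terms of `c` and `k` -/

section Bounds

variable {c k t : ℕ}

lemma three_mul_rainbowDominationNumber_le_of_sum_min_le [NeZero (c * k)] {σ : ZMod 3} {b m : ℕ}
    {S : ZMod 3 → Finset (Fin t)} (hS : IsColorSplit S) (hk : 1 ≤ k) (hc : 3 ≤ c)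
    (hco : Odd c) (hke : Even k) (hσ : σ = 1 ∨ σ = -1) (hA : (k : ZMod 3) ≠ σ - 1)
    (hB : ∀ a, ∑ r, min (S (a + σ * c + r)).card (S (a - σ + r)).card ≤ b)
    (hm : (c - 1) / 2 * (t - 1) + k / 2 * b + m = ((c - 1) / 2 + k / 2) * t) (h3 : 3 ≤ m) :
    3 * rainbowDominationNumber t (generalizedPetersen (c * k) k) ≤
      t * (c * k + (c - 1) / 2 + k / 2) := by
  have := three_mul_rainbowDominationNumber_le_of_choice hS hk hc hco hke hσ hA hB
  linarith

/-- If `3` does not divide `c + 1`, the two classes offered at a place of the row seam differ. Then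
the choice saves a color at every place of both seams, and three places pay for the corner. -/
lemma three_mul_rainbowDominationNumber_le_of_ne_two [NeZero (c * k)] {σ : ZMod 3}
    (ht : t = 4 ∨ t = 5) (hk : 1 ≤ k) (hc : 3 ≤ c) (hco : Odd c) (hke : Even k)
    (hσ : σ = 1 ∨ σ = -1) (hA : (k : ZMod 3) ≠ σ - 1) (hc2 : (c : ZMod 3) ≠ 2)
    (hsize : 3 ≤ (c - 1) / 2 + k / 2) :
    3 * rainbowDominationNumber t (generalizedPetersen (c * k) k) ≤
      t * (c * k + (c - 1) / 2 + k / 2) := by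
  obtain ⟨S, hS⟩ := exists_isColorSplit ht
  have hne : ∀ a : ZMod 3, a + σ * c ≠ a - σ := by
    generalize (c : ZMod 3) = c' at hc2
    rcases hσ with rfl | rfl <;> revert c' <;> decide
  refine three_mul_rainbowDominationNumber_le_of_sum_min_le (b := t - 1)
    (m := (c - 1) / 2 + k / 2) hS hk hc hco hke hσ hA (fun a => ?_) ?_ hsize
  · have := hS.sum_min_card _ _ (hne a)
    omega
  · obtain ⟨s, rfl⟩ : ∃ s, t = s + 1 := ⟨t - 1, by omega⟩
    rw [Nat.add_sub_cancel]
    ring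

/-- Without a saving on the row seam, three places of the column seam pay for the corner. -/
lemma three_mul_rainbowDominationNumber_le_of_seven_le [NeZero (c * k)] (ht : t = 4 ∨ t = 5)
    (hk : 1 ≤ k) (hc : 7 ≤ c) (hco : Odd c) (hke : Even k) (hk3 : (k : ZMod 3) = 0) :
    3 * rainbowDominationNumber t (generalizedPetersen (c * k) k) ≤
      t * (c * k + (c - 1) / 2 + k / 2) := by
  obtain ⟨S, hS⟩ := exists_isColorSplit ht
  refine three_mul_rainbowDominationNumber_le_of_sum_min_le (σ := -1) (b := t)
    (m := (c - 1) / 2) hS hk (by omega) hco hke (Or.inr rfl)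
    (by rw [hk3]; decide) (fun a => ?_) ?_ (by omega)
  · exact (Finset.sum_le_sum fun r _ => min_le_left _ _).trans (hS.sum_card _).le
  · obtain ⟨s, rfl⟩ : ∃ s, t = s + 1 := ⟨t - 1, by omega⟩
    rw [Nat.add_sub_cancel]
    ring

lemma natCast_zmod_three (m : ℕ) : (m % 3 = 0 ∧ (m : ZMod 3) = 0) ∨
    (m % 3 = 1 ∧ (m : ZMod 3) = 1) ∨ (m % 3 = 2 ∧ (m : ZMod 3) = 2) := by
  have h := ZMod.natCast_mod m 3
  have hlt := Nat.mod_lt m three_pos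
  interval_cases m % 3
  · exact Or.inl ⟨rfl, by simpa using h.symm⟩
  · exact Or.inr (Or.inl ⟨rfl, by simpa using h.symm⟩)
  · exact Or.inr (Or.inr ⟨rfl, by simpa using h.symm⟩)

/-- For odd `c` and even `k`, either some slope `σ` makes the seams meet without an extra cost, or
the corner is paid for by the choice on the seams, or `c = 5` and `6 ∣ k`. -/
lemma three_mul_rainbowDominationNumber_le_of_odd_of_even (ht : t = 4 ∨ t = 5)
    (hk : 1 ≤ k) (hc : 3 ≤ c) (hco : Odd c) (hke : Even k) :
    3 * rainbowDominationNumber t (generalizedPetersen (c * k) k) ≤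
      t * (c * k + (c - 1) / 2 + k / 2) := by
  have : NeZero (c * k) := ⟨by positivity⟩
  have hco2 := Nat.odd_iff.1 hco
  have hke2 := Nat.even_iff.1 hke
  have key : ∀ {σ : ZMod 3}, σ = 1 ∨ σ = -1 → (k : ZMod 3) + σ * (c - 1) = 0 →
      3 * rainbowDominationNumber t (generalizedPetersen (c * k) k) ≤
        t * (c * k + (c - 1) / 2 + k / 2) := fun hσ hcorner =>
    let ⟨_, hP, hcard⟩ := exists_placement_odd_even hk hc hco hke hσ hcorner
    three_mul_rainbowDominationNumber_le ht hP hcard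
  rcases natCast_zmod_three k with ⟨hk', hk3⟩ | ⟨hk', hk3⟩ | ⟨hk', hk3⟩ <;>
  rcases natCast_zmod_three c with ⟨hc', hc3⟩ | ⟨hc', hc3⟩ | ⟨hc', hc3⟩
  · exact three_mul_rainbowDominationNumber_le_of_ne_two ht hk hc hco hke (Or.inr rfl)
      (by rw [hk3]; decide) (by rw [hc3]; decide) (by omega)
  · exact key (Or.inl rfl) (by rw [hk3, hc3]; decide)
  · rcases le_or_gt 7 c with h7 | h7
    · exact three_mul_rainbowDominationNumber_le_of_seven_le ht hk h7 hco hke hk3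
    · obtain rfl : c = 5 := by omega
      obtain ⟨P, hP, hcard⟩ := exists_placement_five (by omega) hke hk3
      exact three_mul_rainbowDominationNumber_le ht hP hcard
  · exact key (Or.inl rfl) (by rw [hk3, hc3]; decide)
  · exact three_mul_rainbowDominationNumber_le_of_ne_two ht hk hc hco hke (Or.inl rfl)
      (by rw [hk3]; decide) (by rw [hc3]; decide) (by omega)
  · exact key (Or.inr rfl) (by rw [hk3, hc3]; decide)
  · exact key (Or.inr rfl) (by rw [hk3, hc3]; decide)
  · exact three_mul_rainbowDominationNumber_le_of_ne_two ht hk hc hco hke (Or.inr rfl)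
      (by rw [hk3]; decide) (by rw [hc3]; decide) (by omega)
  · exact key (Or.inl rfl) (by rw [hk3, hc3]; decide)

end Bounds

section Casts

variable {t n g N : ℕ} {x : ℚ}

lemma natCast_le_div_three_mul (h : 3 * g ≤ t * N) (hN : (N : ℚ) ≤ x) :
    (g : ℚ) ≤ (t : ℚ) / 3 * x := by
  have h' : (3 : ℚ) * g ≤ t * N := by exact_mod_cast h
  have := mul_le_mul_of_nonneg_left hN (Nat.cast_nonneg (α := ℚ) t)
  linarith

lemma div_three_mul_lt_natCast {c k : ℕ} (h : t * (c * k) < 3 * g) :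
    (t : ℚ) / 3 * (c * k) < g := by
  have h' : (t : ℚ) * (c * k) < 3 * g := by exact_mod_cast h
  linarith

lemma div_three_mul_le_natCast {c k : ℕ} (h : t * (c * k) ≤ 3 * g) :
    (t : ℚ) / 3 * (c * k) ≤ g := by
  have h' : (t : ℚ) * (c * k) ≤ 3 * g := by exact_mod_cast h
  linarith

lemma exists_sign_of_modEq {k : ℕ} (h : k ≡ 1 [MOD 6] ∨ k ≡ 5 [MOD 6]) :
    Odd k ∧ ∃ σ : ZMod 3, (σ = 1 ∨ σ = -1) ∧ (k : ZMod 3) = σ := by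
  refine ⟨Nat.odd_iff.2 ?_, ?_⟩
  · simp only [Nat.ModEq] at h
    omega
  · rcases natCast_zmod_three k with ⟨hk', hk3⟩ | ⟨hk', hk3⟩ | ⟨hk', hk3⟩
    · simp only [Nat.ModEq] at h
      omega
    · exact ⟨1, Or.inl rfl, hk3⟩
    · exact ⟨-1, Or.inr rfl, hk3.trans (by decide)⟩

end Casts

theorem mainTheorem10 (c k t : ℕ) (hc : 3 ≤ c) (hk : 1 ≤ k) (ht : t = 4 ∨ t = 5) :
    (c ≡ 0 [MOD 6] →
      (k ≡ 1 [MOD 6] ∨ k ≡ 5 [MOD 6] →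
        (rainbowDominationNumber t (generalizedPetersen (c * k) k) : ℚ) = (t : ℚ) / 3 * (c * k)) ∧
      (k ≡ 0 [MOD 2] →
        (t : ℚ) / 3 * (c * k) < rainbowDominationNumber t (generalizedPetersen (c * k) k) ∧
        (rainbowDominationNumber t (generalizedPetersen (c * k) k) : ℚ) ≤
          (t : ℚ) / 3 * (c * (k + 1 / 2))) ∧
      (k ≡ 3 [MOD 6] →
        (t : ℚ) / 3 * (c * k) < rainbowDominationNumber t (generalizedPetersen (c * k) k) ∧
        (rainbowDominationNumber t (generalizedPetersen (c * k) k) : ℚ) ≤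
          (t : ℚ) / 3 * (c * (k + 1)))) ∧
    (Odd c →
      (k ≡ 1 [MOD 6] ∨ k ≡ 5 [MOD 6] →
        (t : ℚ) / 3 * (c * k) < rainbowDominationNumber t (generalizedPetersen (c * k) k) ∧
        (rainbowDominationNumber t (generalizedPetersen (c * k) k) : ℚ) ≤
          (t : ℚ) / 3 * (c * k + ⌈(k : ℚ) / 2⌉)) ∧
      (k ≡ 0 [MOD 2] →
        (t : ℚ) / 3 * (c * k) < rainbowDominationNumber t (generalizedPetersen (c * k) k) ∧
        (rainbowDominationNumber t (generalizedPetersen (c * k) k) : ℚ) ≤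
          (t : ℚ) / 3 * (c * k + ⌊(c : ℚ) / 2⌋ + k / 2)) ∧
      (k ≡ 3 [MOD 6] →
        (t : ℚ) / 3 * (c * k) < rainbowDominationNumber t (generalizedPetersen (c * k) k) ∧
        (rainbowDominationNumber t (generalizedPetersen (c * k) k) : ℚ) ≤
          (t : ℚ) / 3 * (c * (k + 1) + ⌈((k : ℚ) - 2) / 2⌉))) ∧
    (Even c ∧ ¬ c ≡ 0 [MOD 6] →
      (k ≡ 1 [MOD 6] ∨ k ≡ 5 [MOD 6] →
        (t : ℚ) / 3 * (c * k) < rainbowDominationNumber t (generalizedPetersen (c * k) k) ∧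
        (rainbowDominationNumber t (generalizedPetersen (c * k) k) : ℚ) ≤
          (t : ℚ) / 3 * (c * k + k + 1)) ∧
      (k ≡ 0 [MOD 2] →
        (t : ℚ) / 3 * (c * k) < rainbowDominationNumber t (generalizedPetersen (c * k) k) ∧
        (rainbowDominationNumber t (generalizedPetersen (c * k) k) : ℚ) ≤
          (t : ℚ) / 3 * (c * k + c / 2 + k)) ∧
      (k ≡ 3 [MOD 6] →
        (t : ℚ) / 3 * (c * k) < rainbowDominationNumber t (generalizedPetersen (c * k) k) ∧
        (rainbowDominationNumber t (generalizedPetersen (c * k) k) : ℚ) ≤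
          (t : ℚ) / 3 * (c * k + c + k - 2))) := by
  have : NeZero (c * k) := ⟨by positivity⟩
  have hkn : 2 * k < c * k := Nat.mul_lt_mul_of_pos_right hc hk
  have upper : ∀ {N : ℕ} {x : ℚ},
      (∃ P, IsRainbowPlacement (generalizedPetersen (c * k) k) P ∧ P.card ≤ N) → (N : ℚ) ≤ x →
      (rainbowDominationNumber t (generalizedPetersen (c * k) k) : ℚ) ≤ (t : ℚ) / 3 * x :=
    fun ⟨_, hP, hcard⟩ hx =>
      natCast_le_div_three_mul (three_mul_rainbowDominationNumber_le ht hP hcard) hx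
  have lower : ¬ (Even (c * k) ∧ Odd k ∧ 3 ∣ c * k ∧ ¬ 3 ∣ k) →
      (t : ℚ) / 3 * (c * k) < rainbowDominationNumber t (generalizedPetersen (c * k) k) :=
    fun h => div_three_mul_lt_natCast
      (mul_lt_three_mul_rainbowDominationNumber hk hkn (by omega) (by omega) h)
  have lower_even : Even k →
      (t : ℚ) / 3 * (c * k) < rainbowDominationNumber t (generalizedPetersen (c * k) k) :=
    fun h => lower fun h' => Nat.not_odd_iff_even.2 h h'.2.1
  have hk2 : k ≡ 0 [MOD 2] → Even k := fun h => Nat.even_iff.2 h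
  have hk3 : k ≡ 3 [MOD 6] → Odd k ∧ 3 ∣ k ∧ (k : ZMod 3) = 0 := fun h => by
    have h3 : 3 ∣ k := by
      simp only [Nat.ModEq] at h
      omega
    refine ⟨Nat.odd_iff.2 ?_, h3, (ZMod.natCast_eq_zero_iff k 3).2 h3⟩
    simp only [Nat.ModEq] at h
    omega
  have lower_three : k ≡ 3 [MOD 6] →
      (t : ℚ) / 3 * (c * k) < rainbowDominationNumber t (generalizedPetersen (c * k) k) :=
    fun h => lower fun h' => h'.2.2.2 (hk3 h).2.1
  refine ⟨fun hc6 => ?_, fun hco => ?_, fun ⟨hce, hc6⟩ => ?_⟩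
  · have hdvd : 6 ∣ c := (Nat.modEq_zero_iff_dvd).1 hc6
    obtain ⟨m, rfl⟩ : 2 ∣ c := by omega
    have hce : Even (2 * m) := even_two_mul m
    have hc0 : ((2 * m : ℕ) : ZMod 3) = 0 := (ZMod.natCast_eq_zero_iff _ 3).2 (by omega)
    refine ⟨fun h => ?_, fun h => ⟨lower_even (hk2 h), ?_⟩, fun h => ⟨lower_three h, ?_⟩⟩
    · obtain ⟨hko, σ, hσ, hkσ⟩ := exists_sign_of_modEq h
      refine le_antisymm (upper (exists_placement_even_order hk hc hce hc0 hko hσ hkσ) ?_)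
        (div_three_mul_le_natCast
          (mul_le_three_mul_rainbowDominationNumber hk hkn (by omega) (by omega)))
      push_cast
      exact le_rfl
    · refine upper (exists_placement_six_dvd_of_even hk hc hce hc0 (hk2 h)) ?_
      rw [Nat.mul_div_cancel_left _ two_pos]
      push_cast
      exact le_of_eq (by ring)
    · refine upper (exists_placement_six_dvd_of_odd hk hc hce hc0 (hk3 h).1) ?_
      push_cast
      exact le_of_eq (by ring)
  · refine ⟨fun h => ?_, fun h => ⟨lower_even (hk2 h), ?_⟩, fun h => ⟨lower_three h, ?_⟩⟩
    · obtain ⟨hko, σ, hσ, hkσ⟩ := exists_sign_of_modEq h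
      refine ⟨lower fun h' => Nat.not_even_iff_odd.2 (hco.mul hko) h'.1,
        upper (exists_placement_odd_odd hk hc hco hko hσ hkσ) ?_⟩
      obtain ⟨j, rfl⟩ := hko
      have hceil : ⌈((2 * j + 1 : ℕ) : ℚ) / 2⌉ = j + 1 := by
        rw [Int.ceil_eq_iff]
        push_cast
        constructor <;> linarith
      rw [hceil, show (2 * j + 1 + 1) / 2 = j + 1 by omega]
      push_cast
      exact le_rfl
    · refine natCast_le_div_three_mul
        (three_mul_rainbowDominationNumber_le_of_odd_of_even ht hk hc hco (hk2 h)) ?_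
      obtain ⟨m, rfl⟩ := hco
      obtain ⟨j, rfl⟩ := (Nat.modEq_zero_iff_dvd).1 h
      have hfloor : ⌊((2 * m + 1 : ℕ) : ℚ) / 2⌋ = m := by
        rw [Int.floor_eq_iff]
        push_cast
        constructor <;> linarith
      rw [hfloor, Nat.add_sub_cancel, Nat.mul_div_cancel_left _ two_pos,
        Nat.mul_div_cancel_left _ two_pos]
      push_cast
      exact le_of_eq (by ring)
    · have hko := (hk3 h).1
      refine upper (exists_placement_odd_of_odd hk hc hco hko) ?_
      obtain ⟨j, rfl⟩ := hko
      have hceil : ⌈(((2 * j + 1 : ℕ) : ℚ) - 2) / 2⌉ = j := by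
        rw [Int.ceil_eq_iff]
        push_cast
        constructor <;> linarith
      rw [hceil, Nat.add_sub_cancel, Nat.mul_div_cancel_left _ two_pos]
      push_cast [show 1 ≤ c by omega]
      exact le_of_eq (by ring)
  · have hc3 : ¬ 3 ∣ c := fun h3 => hc6 (by
      have := Nat.even_iff.1 hce
      simp only [Nat.ModEq]
      omega)
    have hc2 := Nat.even_iff.1 hce
    refine ⟨fun h => ?_, fun h => ⟨lower_even (hk2 h), ?_⟩, fun h => ⟨lower_three h, ?_⟩⟩
    · obtain ⟨hko, σ, hσ, hkσ⟩ := exists_sign_of_modEq h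
      refine ⟨lower fun h' => ((Nat.prime_three.dvd_mul).1 h'.2.2.1).elim hc3 h'.2.2.2,
        upper (exists_placement_even_odd hk hc hce hko hσ hkσ) ?_⟩
      push_cast
      exact le_rfl
    · refine upper (exists_placement_even_even hk hc hce (hk2 h)) ?_
      obtain ⟨m, rfl⟩ := even_iff_two_dvd.1 hce
      rw [Nat.mul_div_cancel_left _ two_pos]
      push_cast
      exact le_of_eq (by ring)
    · obtain ⟨hko, hk3', hk0⟩ := hk3 h
      have h3k : 3 ≤ k := Nat.le_of_dvd hk hk3'
      have hP : ∃ P, IsRainbowPlacement (generalizedPetersen (c * k) k) P ∧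
          P.card ≤ c * k + c + (k - 2) := by
        rcases natCast_zmod_three c with ⟨hc', _⟩ | ⟨_, hc'⟩ | ⟨_, hc'⟩
        · omega
        · exact exists_placement_even_of_one_mod_three h3k (by omega) hce hko hk0 hc'
        · exact exists_placement_even_of_two_mod_three h3k (by omega) hce hko hk0 hc'
      refine upper hP ?_
      push_cast [show 2 ≤ k by omega]
      exact le_of_eq (by ring)
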